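/- Let $\widetilde F$ be an algebraically closed field of characteristic zero and let $G$ be a cyclic group (written additively) whose order $\mathfrak m=|G|$ is a prime number or equals $4$. Let $C=\bigoplus_{g\in G}C_g$ be a finite dimensional associative (not necessarily unital) $G$-graded $\widetilde F$-algebra with a graded involution $*$, that is, an $\widetilde F$-linear map with $(ab)^*=b^*a^*$, $a^{**}=a$ and $C_g^*= C_g$ for all $g\in G$. Suppose that $C$ is $*$-graded simple: $C^2\neq 0$, and $C$ has no graded two-sided ideals invariant under $*$ other than $0$ and $C$. For a subgroup $H\le G$, a 2-cocycle $\zeta:H\times H\to\widetilde F^{*}$ (for the trivial action), an integer $k\ge 1$ and a tuple $(\theta_1,\dots,\theta_k)\in G^k$, let $\widetilde F^{\zeta}[H]$ be the twisted group algebra with basis $\{\eta_\xi\mid \xi\in H\}$ and product $\eta_\xi\eta_{\xi'}=\zeta(\xi,\xi')\,\eta_{\xi+\xi'}$, and let the matrix algebra $M_k(\widetilde F^{\zeta}[H])$ be $G$-graded by $\deg(E_{ij}\eta_\xi)=-\theta_i+\xi+\theta_j$. A graded involution of $M_k(\widetilde F^{\zeta}[H])$ is called elementary if it maps every $E_{ij}\eta_\xi$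 to $\pm E_{i'j'}\eta_{\xi'}$ for some $i',j'$ and some $\xi'\in H$. Then there are $H$, $\zeta$, $k$ and $(\theta_1,\dots,\theta_k)$ as above, with all values of $\zeta$ in the subfield $\mathbb{Q}(\sqrt[\mathfrak m]{1})\subseteq\widetilde F$ generated by a primitive $\mathfrak m$-th root of unity, such that the $G$-graded algebra $\mathcal B=M_k(\widetilde F^{\zeta}[H])$ is graded simple ($\mathcal B^2\ne 0$, and its only graded two-sided ideals are $0$ and $\mathcal B$), and $C$ is isomorphic as a graded algebra with involution to one of the following: 1. $\mathcal B$ with an elementary graded involution; 2. $\mathcal B\times\mathcal B^{op}$, graded by $(\mathcal B\times\mathcal B^{op})_g=\mathcal B_g\times\mathcal B_g^{op}$, with the exchange involution $(a,b)\mapsto(b,a)$. -/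

import Mathlib

noncomputable section

/-! ### Gradings, graded involutions, simplicity, isomorphisms.
Associative algebras over `F` are not assumed to be unital. -/

/-- `A = ⨁ g, 𝒜 g` as a vector space and `𝒜 g * 𝒜 h ⊆ 𝒜 (g + h)`. -/
structure IsAlgGrading {F G A : Type*} [Field F] [AddCommGroup G]
    [NonUnitalRing A] [Module F A] (𝒜 : G → Submodule F A) : Prop where
  indep : iSupIndep 𝒜
  iSup_eq_top : (⨆ g, 𝒜 g) = ⊤
  mul_mem : ∀ (g h : G) (a b : A), a ∈ 𝒜 g → b ∈ 𝒜 h → a * b ∈ 𝒜 (g + h)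

/-- An `F`-linear anti-automorphism `σ` with `σ ∘ σ = id` that preserves every component. -/
structure IsGradedInvolution {F G A : Type*} [Field F]
    [NonUnitalRing A] [Module F A] (𝒜 : G → Submodule F A) (σ : A →ₗ[F] A) : Prop where
  map_mul : ∀ a b : A, σ (a * b) = σ b * σ a
  involutive : ∀ a : A, σ (σ a) = a
  map_mem : ∀ (g : G) (a : A), a ∈ 𝒜 g → σ a ∈ 𝒜 g

/-- A graded two-sided ideal: `I` is the sum of the subspaces `I ∩ 𝒜 g`. -/
structure IsGradedIdeal {F G A : Type*} [Field F]
    [NonUnitalRing A] [Module F A] (𝒜 : G → Submodule F A) (I : Submodule F A) : Prop where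
  mul_mem_left : ∀ a x : A, x ∈ I → a * x ∈ I
  mul_mem_right : ∀ a x : A, x ∈ I → x * a ∈ I
  graded : I = ⨆ g, I ⊓ 𝒜 g

/-- Graded simple: the multiplication is not zero and there are no proper nonzero graded ideals. -/
structure IsGradedSimple {F G A : Type*} [Field F]
    [NonUnitalRing A] [Module F A] (𝒜 : G → Submodule F A) : Prop where
  mul_ne_zero : ∃ a b : A, a * b ≠ 0
  eq_bot_or_eq_top : ∀ I : Submodule F A, IsGradedIdeal 𝒜 I → I = ⊥ ∨ I = ⊤

/-- `*`-graded simple: the multiplication is not zero and there are no proper nonzero graded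
ideals that are invariant under the involution `σ`. -/
structure IsStarGradedSimple {F G A : Type*} [Field F]
    [NonUnitalRing A] [Module F A] (𝒜 : G → Submodule F A) (σ : A →ₗ[F] A) : Prop where
  mul_ne_zero : ∃ a b : A, a * b ≠ 0
  eq_bot_or_eq_top : ∀ I : Submodule F A, IsGradedIdeal 𝒜 I → (∀ x ∈ I, σ x ∈ I) →
    I = ⊥ ∨ I = ⊤

/-- `(A, 𝒜, σ)` and `(B, ℬ, τ)` are isomorphic as graded algebras with involution. -/
def GradedStarIsomorphic {F G A B : Type*} [Field F]
    [NonUnitalRing A] [Module F A] [NonUnitalRing B] [Module F B]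
    (𝒜 : G → Submodule F A) (σ : A →ₗ[F] A) (ℬ : G → Submodule F B) (τ : B →ₗ[F] B) : Prop :=
  ∃ φ : A ≃ₗ[F] B, (∀ a b : A, φ (a * b) = φ a * φ b) ∧
    (∀ (g : G) (a : A), a ∈ 𝒜 g ↔ φ a ∈ ℬ g) ∧ ∀ a : A, φ (σ a) = τ (φ a)

/-! ### Twisted group algebras -/

/-- A 2-cocycle on `L` with values in the multiplicative group of `F` (trivial action). -/
structure TwoCocycle (L F : Type*) [AddCommGroup L] [Field F] where
  toFun : L → L → Fˣ
  cocycle : ∀ x y z : L, toFun x y * toFun (x + y) z = toFun y z * toFun x (y + z)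

/-- The twisted group algebra `F^ζ[L]`: the vector space with basis `η x`, `x : L`, and the
product `η x * η y = ζ x y • η (x + y)`. -/
def TwistedGroupAlgebra {L F : Type*} [AddCommGroup L] [Field F] (_ζ : TwoCocycle L F) : Type _ :=
  L →₀ F

namespace TwistedGroupAlgebra

variable {L F : Type*} [AddCommGroup L] [Field F] {ζ : TwoCocycle L F}

instance : AddCommGroup (TwistedGroupAlgebra ζ) := inferInstanceAs (AddCommGroup (L →₀ F))

instance : Module F (TwistedGroupAlgebra ζ) := inferInstanceAs (Module F (L →₀ F))

/-- The basis of `F^ζ[L]` indexed by `L`. -/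
def basis (ζ : TwoCocycle L F) : Module.Basis L F (TwistedGroupAlgebra ζ) :=
  .ofRepr (LinearEquiv.refl F (L →₀ F))

/-- The basis element `η x`. -/
def η (ζ : TwoCocycle L F) (x : L) : TwistedGroupAlgebra ζ := basis ζ x

/-- The multiplication as a bilinear map, determined by `η x * η y = ζ x y • η (x + y)`. -/
def mulLin (ζ : TwoCocycle L F) :
    TwistedGroupAlgebra ζ →ₗ[F] TwistedGroupAlgebra ζ →ₗ[F] TwistedGroupAlgebra ζ :=
  (basis ζ).constr F fun x => (basis ζ).constr F fun y => (ζ.toFun x y : F) • η ζ (x + y)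

instance : Mul (TwistedGroupAlgebra ζ) := ⟨fun a b => mulLin ζ a b⟩

theorem mul_def (a b : TwistedGroupAlgebra ζ) : a * b = mulLin ζ a b := rfl

theorem η_mul_η (x y : L) : η ζ x * η ζ y = (ζ.toFun x y : F) • η ζ (x + y) := by
  simp [mul_def, mulLin, η]

theorem induction_on {p : TwistedGroupAlgebra ζ → Prop} (a : TwistedGroupAlgebra ζ)
    (h0 : p 0) (hadd : ∀ a b, p a → p b → p (a + b)) (hη : ∀ (c : F) (x : L), p (c • η ζ x)) :
    p a := by
  have h : a ∈ Submodule.span F (Set.range (basis ζ)) := by simp [(basis ζ).span_eq]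
  induction h using Submodule.closure_induction with
  | zero => exact h0
  | add x y _ _ hx hy => exact hadd x y hx hy
  | smul_mem r x hx => obtain ⟨y, rfl⟩ := hx; exact hη r y

theorem smul_mul' (c : F) (a b : TwistedGroupAlgebra ζ) : (c • a) * b = c • (a * b) := by
  simp [mul_def]

theorem mul_smul' (c : F) (a b : TwistedGroupAlgebra ζ) : a * (c • b) = c • (a * b) := by
  simp [mul_def]

theorem add_mul' (a b c : TwistedGroupAlgebra ζ) : (a + b) * c = a * c + b * c := by
  simp [mul_def]

theorem mul_add' (a b c : TwistedGroupAlgebra ζ) : a * (b + c) = a * b + a * c := by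
  simp [mul_def]

theorem zero_mul' (a : TwistedGroupAlgebra ζ) : 0 * a = 0 := by
  simp [mul_def]

theorem mul_zero' (a : TwistedGroupAlgebra ζ) : a * 0 = 0 := by
  simp [mul_def]

theorem mul_assoc' (a b c : TwistedGroupAlgebra ζ) : a * b * c = a * (b * c) := by
  induction a using induction_on with
  | h0 => simp only [zero_mul']
  | hadd a a' h h' => simp only [add_mul', h, h']
  | hη r x =>
    induction b using induction_on with
    | h0 => simp only [zero_mul', mul_zero']
    | hadd b b' h h' => simp only [add_mul', mul_add', h, h']
    | hη s y =>
      induction c using induction_on with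
      | h0 => simp only [mul_zero']
      | hadd c c' h h' => simp only [mul_add', h, h']
      | hη t z =>
        have h := congrArg Units.val (ζ.cocycle x y z)
        simp only [Units.val_mul] at h
        simp only [smul_mul', mul_smul', η_mul_η, smul_smul, add_assoc]
        congr 1
        linear_combination (r * s * t) * h

instance : NonUnitalRing (TwistedGroupAlgebra ζ) where
  left_distrib := mul_add'
  right_distrib := add_mul'
  zero_mul := zero_mul'
  mul_zero := mul_zero'
  mul_assoc := mul_assoc'

instance : IsScalarTower F (TwistedGroupAlgebra ζ) (TwistedGroupAlgebra ζ) := ⟨smul_mul'⟩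

instance : SMulCommClass F (TwistedGroupAlgebra ζ) (TwistedGroupAlgebra ζ) :=
  ⟨fun c a b => (mul_smul' c a b).symm⟩

end TwistedGroupAlgebra

/-! ### The graded matrix algebras over twisted group algebras -/

section MatrixAlgebra

variable {F G : Type*} [Field F] [AddCommGroup G]

/-- The matrix algebra `M_k(F^ζ[H])`. -/
abbrev TwistedMatrix {H : AddSubgroup G} (ζ : TwoCocycle H F) (k : ℕ) : Type _ :=
  Matrix (Fin k) (Fin k) (TwistedGroupAlgebra ζ)

/-- The element `E_{ij} η_ξ`. -/
def basisElt {H : AddSubgroup G} (ζ : TwoCocycle H F) {k : ℕ} (i j : Fin k) (ξ : H) :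
    TwistedMatrix ζ k :=
  Matrix.single i j (TwistedGroupAlgebra.η ζ ξ)

/-- The `G`-grading of `M_k(F^ζ[H])` given by `θ`: `E_{ij} η_ξ` has degree `-θ_i + ξ + θ_j`. -/
def matrixGrading {H : AddSubgroup G} (ζ : TwoCocycle H F) {k : ℕ} (θ : Fin k → G) (g : G) :
    Submodule F (TwistedMatrix ζ k) :=
  Submodule.span F {a | ∃ (i j : Fin k) (ξ : H), -θ i + (ξ : G) + θ j = g ∧ a = basisElt ζ i j ξ}

/-- A graded involution of `M_k(F^ζ[H])` is elementary if it maps each `E_{ij} η_ξ` to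
`± E_{i'j'} η_ξ'` for some `i'`, `j'`, `ξ'`. -/
structure IsElementaryInvolution {H : AddSubgroup G} (ζ : TwoCocycle H F) {k : ℕ} (θ : Fin k → G)
    (τ : TwistedMatrix ζ k →ₗ[F] TwistedMatrix ζ k) : Prop where
  isGradedInvolution : IsGradedInvolution (matrixGrading ζ θ) τ
  elementary : ∀ (i j : Fin k) (ξ : H), ∃ (i' j' : Fin k) (ξ' : H),
    τ (basisElt ζ i j ξ) = basisElt ζ i' j' ξ' ∨ τ (basisElt ζ i j ξ) = -basisElt ζ i' j' ξ'

end MatrixAlgebra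

/-! ### The algebra `B × B^op` -/

/-- The grading of `B × B^op` with components `ℬ g × (ℬ g)^op`. -/
def prodOpGrading {F G B : Type*} [Field F] [NonUnitalRing B] [Module F B]
    (ℬ : G → Submodule F B) (g : G) : Submodule F (B × Bᵐᵒᵖ) :=
  (ℬ g).prod ((ℬ g).comap (MulOpposite.opLinearEquiv F).symm.toLinearMap)

/-- The exchange involution `(a, b) ↦ (b, a)` of `B × B^op`. -/
def exchange (F B : Type*) [Field F] [NonUnitalRing B] [Module F B] :
    (B × Bᵐᵒᵖ) →ₗ[F] (B × Bᵐᵒᵖ) :=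
  ((MulOpposite.opLinearEquiv F).symm.toLinearMap ∘ₗ LinearMap.snd F B Bᵐᵒᵖ).prod
    ((MulOpposite.opLinearEquiv F).toLinearMap ∘ₗ LinearMap.fst F B Bᵐᵒᵖ)

/-- The subfield of `F` generated over `ℚ` by the primitive `m`-th roots of unity. -/
def cyclotomicSubfield (F : Type*) [Field F] [CharZero F] (m : ℕ) : IntermediateField ℚ F :=
  IntermediateField.adjoin ℚ {ω : F | IsPrimitiveRoot ω m}

end

/-! Suppose first that the algebra `A` is graded simple. A minimal graded left ideal is generated by
an idempotent `e` of degree `0`, and every nonzero homogeneous element of `e A e` is invertible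
there. Over an algebraically closed field the degree `0` part of `e A e` is `F e`, so each nonzero
component is a line and the degrees that occur form a subgroup `H`. As `G` is cyclic, so is `H`.
Rescaling a homogeneous element over a generator by a root makes its power of exponent `|H|` equal
to `e`, and its powers then identify `e A e` with the ordinary group algebra. Hence the cocycle can
always be taken trivial, and its values certainly lie in the cyclotomic field
(`IsMinimalIdempotent.exists_isGroupCorner`).

The left ideal `A e` is a free graded right module over `e A e`. A homogeneous basis `v i` with dual
elements `w i` in `e A` gives matrix units `v i * η ξ * w j` and an isomorphism with the matrix
algebra (`IsFrame.exists_linearEquiv`).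

An involution `σ` gives the pairing `(x, y) ↦ σ x * y` from `A e` to `σ e * A * e`. This space is `t
* (e A e)` for a homogeneous `t`, so the pairing behaves like a hermitian form over a graded
division algebra. Graded Gram–Schmidt (`IsStarSystem.exists_extension`) splits off either one
anisotropic vector, normalised by a square root, or a hyperbolic pair. For the resulting basis, `w
i` is up to sign a multiple of `σ (v (inv i))` by basis elements of the corner, so `σ` permutes the
matrix units up to sign.

If `A` is only simple with involution, a proper nonzero graded ideal `I` satisfies `A = I ⊕ σ I`.
The ideal `I` is itself graded simple, the first part describes it without any involution, and `σ`
exchanges the two summands (`IsStarGradedSimple.split`, `IsStarGradedSimple.isGradedSimple_ideal`).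
-/

/-! ### Projections onto the components of a grading -/

section Projections

variable {F G A : Type*} [Field F] [AddCommGroup G] [NonUnitalRing A] [Module F A]
  {𝒜 : G → Submodule F A}

namespace IsAlgGrading

open Classical in
/-- The decomposition into homogeneous components. -/
noncomputable def directSumEquiv (h : IsAlgGrading 𝒜) : (DirectSum G fun g => 𝒜 g) ≃ₗ[F] A :=
  LinearEquiv.ofBijective (DirectSum.coeLinearMap 𝒜)
    (show Function.Bijective (DirectSum.coeLinearMap 𝒜) from
      DirectSum.isInternal_submodule_of_iSupIndep_of_iSup_eq_top h.indep h.iSup_eq_top)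

open Classical in
/-- The projection onto the component of degree `g`. -/
noncomputable def proj (h : IsAlgGrading 𝒜) (g : G) : A →ₗ[F] A :=
  (𝒜 g).subtype ∘ₗ DirectSum.component F G (fun g => 𝒜 g) g ∘ₗ
    h.directSumEquiv.symm.toLinearMap

theorem proj_mem (h : IsAlgGrading 𝒜) (g : G) (x : A) : h.proj g x ∈ 𝒜 g := by
  simp [proj]

open Classical in
theorem proj_of_mem (h : IsAlgGrading 𝒜) {g : G} {x : A} (hx : x ∈ 𝒜 g) (k : G) :
    h.proj k x = if k = g then x else 0 := by
  have hs : h.directSumEquiv.symm x = DirectSum.lof F G (fun g => 𝒜 g) g ⟨x, hx⟩ := by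
    rw [LinearEquiv.symm_apply_eq]
    simp [directSumEquiv]
  simp only [proj, LinearMap.comp_apply, LinearEquiv.coe_coe, hs]
  split_ifs with hk
  · subst hk
    simp [DirectSum.component.lof_self]
  · rw [DirectSum.component.of, dif_neg (Ne.symm hk)]
    simp

theorem proj_self (h : IsAlgGrading 𝒜) {g : G} {x : A} (hx : x ∈ 𝒜 g) : h.proj g x = x := by
  simp [h.proj_of_mem hx]

theorem proj_ne (h : IsAlgGrading 𝒜) {g k : G} {x : A} (hx : x ∈ 𝒜 g) (hk : k ≠ g) :
    h.proj k x = 0 := by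
  simp [h.proj_of_mem hx, hk]

theorem eq_of_mem_of_mem (h : IsAlgGrading 𝒜) {g k : G} {x : A} (hg : x ∈ 𝒜 g) (hk : x ∈ 𝒜 k)
    (hx : x ≠ 0) : g = k := by
  by_contra hne
  exact hx ((h.proj_self hg).symm.trans (h.proj_ne hk hne))

theorem induction_on (h : IsAlgGrading 𝒜) {p : A → Prop} (x : A)
    (hom : ∀ g, ∀ x ∈ 𝒜 g, p x) (h0 : p 0) (hadd : ∀ x y, p x → p y → p (x + y)) : p x :=
  Submodule.iSup_induction 𝒜 (motive := p) (x := x) (by simp [h.iSup_eq_top]) hom h0 hadd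

theorem sum_proj [Fintype G] (h : IsAlgGrading 𝒜) (x : A) : ∑ g, h.proj g x = x := by
  classical
  induction x using h.induction_on with
  | hom g x hx => simp [h.proj_of_mem hx]
  | h0 => simp
  | hadd x y hx hy => simp [Finset.sum_add_distrib, hx, hy]

theorem eq_zero_of_proj (h : IsAlgGrading 𝒜) {x : A} (hx : ∀ g, h.proj g x = 0) : x = 0 := by
  classical
  have : h.directSumEquiv.symm x = 0 := by
    refine DFinsupp.ext fun g => Subtype.ext ?_
    exact hx g
  simpa using this

/-- Multiplication by a homogeneous element on either side and, with `d = 0`, a graded involution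
are all instances. -/
theorem map_proj (h : IsAlgGrading 𝒜) {d : G} (f : A →ₗ[F] A)
    (hf : ∀ g, ∀ x ∈ 𝒜 g, f x ∈ 𝒜 (g + d)) (g : G) (x : A) :
    h.proj (g + d) (f x) = f (h.proj g x) := by
  classical
  induction x using h.induction_on with
  | hom k x hx =>
    rw [h.proj_of_mem (hf k x hx), h.proj_of_mem hx]
    simp only [add_left_inj]
    split_ifs <;> simp
  | h0 => simp
  | hadd x y hx hy => simp [hx, hy]

theorem proj_mul_right [IsScalarTower F A A] (h : IsAlgGrading 𝒜) {d : G} {x : A} (hx : x ∈ 𝒜 d)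
    (g : G) (a : A) : h.proj (g + d) (a * x) = h.proj g a * x := by
  let f : A →ₗ[F] A :=
    { toFun := fun a => a * x
      map_add' := fun a b => add_mul a b x
      map_smul' := fun c a => smul_mul_assoc c a x }
  exact h.map_proj f (fun g a ha => h.mul_mem g d a x ha hx) g a

theorem proj_mul_left [SMulCommClass F A A] (h : IsAlgGrading 𝒜) {d : G} {x : A} (hx : x ∈ 𝒜 d)
    (g : G) (a : A) : h.proj (d + g) (x * a) = x * h.proj g a := by
  let f : A →ₗ[F] A :=
    { toFun := fun a => x * a
      map_add' := fun a b => mul_add x a b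
      map_smul' := fun c a => mul_smul_comm c x a }
  rw [add_comm]
  exact h.map_proj f (fun g a ha => add_comm d g ▸ h.mul_mem d g x a hx ha) g a

theorem graded_of_proj_mem [Fintype G] (h : IsAlgGrading 𝒜) {I : Submodule F A}
    (hI : ∀ x ∈ I, ∀ g, h.proj g x ∈ I) : I = ⨆ g, I ⊓ 𝒜 g := by
  apply le_antisymm
  · intro x hx
    rw [← h.sum_proj x]
    exact Submodule.sum_mem _ fun g _ =>
      Submodule.mem_iSup_of_mem g ⟨hI x hx g, h.proj_mem g x⟩
  · exact iSup_le fun g => inf_le_left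

theorem proj_mem_of_graded (h : IsAlgGrading 𝒜) {I : Submodule F A} (hI : I = ⨆ g, I ⊓ 𝒜 g)
    {x : A} (hx : x ∈ I) (g : G) : h.proj g x ∈ I := by
  classical
  rw [hI] at hx
  induction hx using Submodule.iSup_induction' with
  | mem k x hx =>
    rw [h.proj_of_mem hx.2]
    split_ifs
    · exact hx.1
    · exact I.zero_mem
  | zero => simp
  | add x y _ _ hx hy =>
    rw [map_add]
    exact I.add_mem hx hy

end IsAlgGrading

end Projections

/-! ### Graded simple algebras are graded prime -/

section Prime

variable {F G A : Type*} [Field F] [AddCommGroup G] [Fintype G] [NonUnitalRing A] [Module F A]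
  [SMulCommClass F A A] {𝒜 : G → Submodule F A}

namespace IsGradedSimple

/-- The elements killed by all left multiplications form a graded ideal. If it were everything, the
product would vanish identically. -/
theorem eq_zero_of_forall_mul (hS : IsGradedSimple 𝒜) (h : IsAlgGrading 𝒜) {a : A}
    (ha : ∀ c, c * a = 0) : a = 0 := by
  let I : Submodule F A :=
    { carrier := {a | ∀ c, c * a = 0}
      add_mem' := fun hx hy c => by rw [mul_add, hx c, hy c, add_zero]
      zero_mem' := fun c => mul_zero c
      smul_mem' := fun r x hx c => by rw [mul_smul_comm, hx c, smul_zero] }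
  have hI : IsGradedIdeal 𝒜 I := by
    refine ⟨fun b x hx c => ?_, fun b x hx c => ?_, h.graded_of_proj_mem fun x hx g c => ?_⟩
    · rw [← mul_assoc, hx]
    · rw [← mul_assoc, hx, zero_mul]
    · induction c using h.induction_on with
      | hom k c hc => rw [← h.proj_mul_left hc, hx c, map_zero]
      | h0 => rw [zero_mul]
      | hadd c c' hc hc' => rw [add_mul, hc, hc', add_zero]
  rcases hS.eq_bot_or_eq_top I hI with hb | ht
  · have : a ∈ I := ha
    simpa [hb] using this
  · obtain ⟨x, y, hxy⟩ := hS.mul_ne_zero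
    have : y ∈ I := by simp [ht]
    exact absurd (this x) hxy

/-- Graded primeness: `{y | y A e = 0}` is a graded ideal, and if it were everything, two uses of
the preceding annihilator lemma would give `e = 0`. -/
theorem eq_zero_of_forall_mul_mul [IsScalarTower F A A] (hS : IsGradedSimple 𝒜)
    (h : IsAlgGrading 𝒜) {d : G} {e : A}
    (he : e ∈ 𝒜 d) (he0 : e ≠ 0) {y : A} (hy : ∀ c, y * c * e = 0) : y = 0 := by
  let I : Submodule F A :=
    { carrier := {y | ∀ c, y * c * e = 0}
      add_mem' := fun hx hy c => by rw [add_mul, add_mul, hx c, hy c, add_zero]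
      zero_mem' := fun c => by rw [zero_mul, zero_mul]
      smul_mem' := fun r x hx c => by rw [smul_mul_assoc, smul_mul_assoc, hx c, smul_zero] }
  have hI : IsGradedIdeal 𝒜 I := by
    refine ⟨fun b x hx c => ?_, fun b x hx c => ?_, h.graded_of_proj_mem fun x hx g c => ?_⟩
    · rw [mul_assoc b, mul_assoc b, hx, mul_zero]
    · rw [mul_assoc x, hx]
    · induction c using h.induction_on with
      | hom k c hc => rw [← h.proj_mul_right hc, ← h.proj_mul_right he, hx c, map_zero]
      | h0 => rw [mul_zero, zero_mul]
      | hadd c c' hc hc' => rw [mul_add, add_mul, hc, hc', add_zero]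
  rcases hS.eq_bot_or_eq_top I hI with hb | ht
  · have : y ∈ I := hy
    simpa [hb] using this
  · refine absurd ?_ he0
    refine hS.eq_zero_of_forall_mul h fun c => hS.eq_zero_of_forall_mul h fun b => ?_
    have : b ∈ I := by simp [ht]
    rw [← mul_assoc]
    exact this c

theorem exists_mul_mul_ne_zero [IsScalarTower F A A] (hS : IsGradedSimple 𝒜)
    (h : IsAlgGrading 𝒜) {d : G} {e : A}
    (he : e ∈ 𝒜 d) (he0 : e ≠ 0) {y : A} (hy : y ≠ 0) : ∃ g, ∃ c ∈ 𝒜 g, y * c * e ≠ 0 := by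
  by_contra! hc
  refine hy (hS.eq_zero_of_forall_mul_mul h he he0 fun c => ?_)
  induction c using h.induction_on with
  | hom k c hck => exact hc k c hck
  | h0 => rw [mul_zero, zero_mul]
  | hadd c c' hc hc' => rw [mul_add, add_mul, hc, hc', add_zero]

theorem exists_mul_ne_zero (hS : IsGradedSimple 𝒜) (h : IsAlgGrading 𝒜) {y : A} (hy : y ≠ 0) :
    ∃ g, ∃ c ∈ 𝒜 g, c * y ≠ 0 := by
  by_contra! hc
  refine hy (hS.eq_zero_of_forall_mul h fun c => ?_)
  induction c using h.induction_on with
  | hom k c hck => exact hc k c hck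
  | h0 => rw [zero_mul]
  | hadd c c' hc hc' => rw [add_mul, hc, hc', add_zero]

/-- A graded simple algebra contains an idempotent `e` of degree `0` that generates a minimal
graded left ideal. -/
theorem exists_idempotent [IsScalarTower F A A] [FiniteDimensional F A] (hS : IsGradedSimple 𝒜)
    (h : IsAlgGrading 𝒜) :
    ∃ e ∈ 𝒜 0, e ≠ 0 ∧ e * e = e ∧ ∀ g, ∀ x ∈ 𝒜 g, x * e = x → x ≠ 0 → ∃ c, c * x = e := by
  classical
  let L : A → Submodule F A := fun x =>
    LinearMap.range (show A →ₗ[F] A from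
      { toFun := fun a => a * x
        map_add' := fun a b => add_mul a b x
        map_smul' := fun c a => smul_mul_assoc c a x })
  have hL : ∀ x y, y ∈ L x ↔ ∃ c, c * x = y := fun x y => Iff.rfl
  -- A homogeneous `x` is chosen with `A x` of least dimension. Any nonzero homogeneous `y` in `A x`
  -- then has `A y = A x`.
  have hex : ∃ n : ℕ, ∃ g, ∃ x ∈ 𝒜 g, x ≠ 0 ∧ Module.finrank F (L x) = n := by
    obtain ⟨a, b, hab⟩ := hS.mul_ne_zero
    have ha : a ≠ 0 := by
      rintro rfl
      simp at hab
    obtain ⟨g, hg⟩ : ∃ g, h.proj g a ≠ 0 := by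
      by_contra! hg
      exact ha (h.eq_zero_of_proj hg)
    exact ⟨_, g, _, h.proj_mem g a, hg, rfl⟩
  obtain ⟨d, x, hx, hx0, hn⟩ := Nat.find_spec hex
  have hmin : ∀ g, ∀ y ∈ 𝒜 g, y ≠ 0 → y ∈ L x → L y = L x := by
    intro g y hy hy0 hyx
    apply Submodule.eq_of_le_of_finrank_le
    · rintro _ ⟨c, rfl⟩
      obtain ⟨b, rfl⟩ := (hL _ _).1 hyx
      exact (hL _ _).2 ⟨c * b, mul_assoc c b x⟩
    · rw [hn]
      exact Nat.find_min' hex ⟨g, y, hy, hy0, rfl⟩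
  obtain ⟨g, c, hc, hxcx⟩ := hS.exists_mul_mul_ne_zero h hx hx0 hx0
  obtain ⟨k, b, hb, hbx⟩ := hS.exists_mul_ne_zero h hxcx
  have hz : c * x ∈ 𝒜 (g + d) := h.mul_mem _ _ _ _ hc hx
  have hz0 : c * x ≠ 0 := by
    intro h0
    rw [mul_assoc, h0, mul_zero] at hxcx
    exact hxcx rfl
  have hz' : (b * x) * (c * x) ≠ 0 := by simpa [mul_assoc] using hbx
  have hzz : (b * x) * (c * x) ∈ 𝒜 ((k + d) + (g + d)) :=
    h.mul_mem _ _ _ _ (h.mul_mem _ _ _ _ hb hx) hz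
  -- With `z = c * x`, right multiplication by `z` does not kill `b * x`, so minimality puts `z` in
  -- `A ((b * x) * z)`. Thus `r * b * x` fixes `z` from the left, and so does its degree `0` part,
  -- the desired idempotent.
  obtain ⟨r, hr⟩ : ∃ r, r * ((b * x) * (c * x)) = c * x := by
    rw [← hL, hmin _ _ hzz hz' ((hL _ _).2 ⟨b * x * c, by simp [mul_assoc]⟩)]
    exact (hL _ _).2 ⟨c, rfl⟩
  let e := h.proj 0 (r * b * x)
  have he : e ∈ 𝒜 0 := h.proj_mem _ _
  have hez : e * (c * x) = c * x := by
    rw [← h.proj_mul_right hz, zero_add]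
    have : r * b * x * (c * x) = c * x := by simpa only [mul_assoc] using hr
    rw [this, h.proj_self hz]
  have heL : e ∈ L x := by
    refine (hL _ _).2 ⟨h.proj (-d) (r * b), ?_⟩
    rw [← h.proj_mul_right hx, neg_add_cancel]
  have he0 : e ≠ 0 := by
    intro h0
    rw [h0, zero_mul] at hez
    exact hz0 hez.symm
  have hee : e * e = e := by
    -- The element `e * e - e` kills `z` from the left. If it were nonzero, it would generate all of
    -- `A x`, including `b * x`, contradicting `(b * x) * z ≠ 0`.
    by_contra hne
    have hne' : e * e - e ≠ 0 := sub_ne_zero.2 hne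
    have hm : e * e - e ∈ 𝒜 0 :=
      Submodule.sub_mem _ (by simpa using h.mul_mem _ _ _ _ he he) he
    have hmL : e * e - e ∈ L x := by
      refine Submodule.sub_mem _ ?_ heL
      obtain ⟨q, hq⟩ := (hL _ _).1 heL
      exact (hL _ _).2 ⟨e * q, by rw [mul_assoc, hq]⟩
    obtain ⟨q, hq⟩ : ∃ q, q * (e * e - e) = b * x := by
      rw [← hL, hmin _ _ hm hne' hmL]
      exact (hL _ _).2 ⟨b, rfl⟩
    apply hz'
    rw [← hq, mul_assoc, sub_mul, mul_assoc, hez, hez, sub_self, mul_zero]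
  refine ⟨e, he, he0, hee, fun g y hy hye hy0 => ?_⟩
  rw [← hL, hmin g y hy hy0]
  · exact heL
  · obtain ⟨q, hq⟩ := (hL _ _).1 heL
    exact (hL _ _).2 ⟨y * q, by rw [mul_assoc, hq, hye]⟩

end IsGradedSimple

end Prime

/-! ### The corner of a primitive homogeneous idempotent -/

section Corner

variable {F G A : Type*} [Field F] [AddCommGroup G] [NonUnitalRing A] [Module F A]

/-- A nonzero idempotent `e` of degree `0` such that `A e` is a minimal graded left ideal. -/
structure IsMinimalIdempotent (𝒜 : G → Submodule F A) (e : A) : Prop where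
  mem : e ∈ 𝒜 0
  ne_zero : e ≠ 0
  mul_self : e * e = e
  exists_mul_eq : ∀ g, ∀ x ∈ 𝒜 g, x * e = x → x ≠ 0 → ∃ c, c * x = e

/-- The elements `η ξ`, `ξ ∈ H`, form a basis of `e A e` that consists of homogeneous elements
and is multiplicative. -/
structure IsGroupCorner (𝒜 : G → Submodule F A) (H : AddSubgroup G) (e : A) (η : H → A) :
    Prop where
  mem : ∀ ξ : H, η ξ ∈ 𝒜 ξ
  zero : η 0 = e
  mul : ∀ ξ ξ' : H, η ξ * η ξ' = η (ξ + ξ')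
  ne_zero : e ≠ 0
  exists_eq : ∀ g, ∀ x ∈ 𝒜 g, e * x = x → x * e = x → x ≠ 0 →
    ∃ (ξ : H) (c : F), (ξ : G) = g ∧ c ≠ 0 ∧ x = c • η ξ

variable {𝒜 : G → Submodule F A} {e : A}

namespace IsMinimalIdempotent

theorem exists_left_inverse [IsScalarTower F A A] (he : IsMinimalIdempotent 𝒜 e)
    (h : IsAlgGrading 𝒜) {g : G} {x : A}
    (hx : x ∈ 𝒜 g) (hex : e * x = x) (hxe : x * e = x) (hx0 : x ≠ 0) :
    ∃ y ∈ 𝒜 (-g), e * y = y ∧ y * e = y ∧ y * x = e := by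
  obtain ⟨c, hc⟩ := he.exists_mul_eq g x hx hxe hx0
  have hc' : h.proj (-g) c * x = e := by
    rw [← h.proj_mul_right hx, hc, neg_add_cancel, h.proj_self he.mem]
  refine ⟨e * h.proj (-g) c * e, ?_, ?_, ?_, ?_⟩
  · simpa using h.mul_mem _ _ _ _ (h.mul_mem _ _ _ _ he.mem (h.proj_mem (-g) c)) he.mem
  · rw [← mul_assoc, ← mul_assoc, he.mul_self]
  · rw [mul_assoc, he.mul_self]
  · rw [mul_assoc, hex, mul_assoc, hc', he.mul_self]

/-- The left inverse has a left inverse of its own, which must be `x`. -/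
theorem exists_inverse [IsScalarTower F A A] (he : IsMinimalIdempotent 𝒜 e)
    (h : IsAlgGrading 𝒜) {g : G} {x : A}
    (hx : x ∈ 𝒜 g) (hex : e * x = x) (hxe : x * e = x) (hx0 : x ≠ 0) :
    ∃ y ∈ 𝒜 (-g), e * y = y ∧ y * e = y ∧ y * x = e ∧ x * y = e := by
  obtain ⟨y, hy, hey, hye, hyx⟩ := he.exists_left_inverse h hx hex hxe hx0
  have hy0 : y ≠ 0 := by
    rintro rfl
    exact he.ne_zero (by rw [← hyx, zero_mul])
  obtain ⟨z, -, -, hze, hzy⟩ := he.exists_left_inverse h hy hey hye hy0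
  have hzx : z = x := by
    rw [← hze, ← hyx, ← mul_assoc, hzy, hex]
  exact ⟨y, hy, hey, hye, hyx, hzx ▸ hzy⟩

variable [IsScalarTower F A A] [SMulCommClass F A A]

/-- Left multiplication by `x` on `e A` has an eigenvalue `c`. The difference `x - c • e` kills an
eigenvector, so it cannot have a left inverse and must be zero. -/
theorem exists_eq_smul [FiniteDimensional F A] [IsAlgClosed F] (he : IsMinimalIdempotent 𝒜 e)
    (h : IsAlgGrading 𝒜) {x : A}
    (hx : x ∈ 𝒜 0) (hex : e * x = x) (hxe : x * e = x) : ∃ c : F, x = c • e := by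
  let W : Submodule F A :=
    { carrier := {y | e * y = y}
      add_mem' := fun {a b} ha hb => by
        change e * (a + b) = a + b
        rw [mul_add, ha, hb]
      zero_mem' := mul_zero e
      smul_mem' := fun c a ha => by
        change e * (c • a) = c • a
        rw [mul_smul_comm, ha] }
  let f : W →ₗ[F] W :=
    { toFun := fun y => ⟨x * y, by change e * (x * y) = x * y; rw [← mul_assoc, hex]⟩
      map_add' := fun a b => Subtype.ext (mul_add x a b)
      map_smul' := fun c a => Subtype.ext (mul_smul_comm c x (a : A)) }
  have : Nontrivial W := ⟨⟨⟨e, he.mul_self⟩, 0, fun h0 => he.ne_zero (congrArg Subtype.val h0)⟩⟩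
  obtain ⟨c, hc⟩ := Module.End.exists_eigenvalue f
  obtain ⟨v, hv⟩ := hc.exists_hasEigenvector
  have hv1 : x * (v : A) = c • (v : A) := congrArg Subtype.val hv.apply_eq_smul
  have hv2 : e * (v : A) = v := v.2
  refine ⟨c, ?_⟩
  by_contra hne
  have hne' : x - c • e ≠ 0 := sub_ne_zero.2 hne
  obtain ⟨y, -, -, -, hy⟩ := he.exists_left_inverse h (x := x - c • e)
    (Submodule.sub_mem _ hx (Submodule.smul_mem _ c he.mem))
    (by rw [mul_sub, hex, mul_smul_comm, he.mul_self])
    (by rw [sub_mul, hxe, smul_mul_assoc, he.mul_self]) hne'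
  apply hv.2
  apply Subtype.ext
  rw [← hv2, ← hy, mul_assoc, sub_mul, hv1, smul_mul_assoc, hv2, sub_self, mul_zero]
  rfl

/-- Invertibility of homogeneous elements makes the support of `e A e` a subgroup, which is cyclic.
A suitably scaled element `y` over a generator `γ` has `y ^ N = e`, where `N` is the order of `γ`,
so its powers multiply exactly as the elements of the support add. -/
theorem exists_isGroupCorner [FiniteDimensional F A] [IsAlgClosed F] [Finite G] [IsAddCyclic G]
    (he : IsMinimalIdempotent 𝒜 e) (h : IsAlgGrading 𝒜) :
    ∃ (H : AddSubgroup G) (η : H → A), IsGroupCorner 𝒜 H e η := by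
  have hmul : ∀ {g k : G} {x y : A}, x ∈ 𝒜 g → y ∈ 𝒜 k → e * x = x → x * e = x → e * y = y →
      y * e = y → x ≠ 0 → y ≠ 0 → x * y ≠ 0 := by
    intro g k x y hx hy hex hxe hey hye hx0 hy0 h0
    obtain ⟨z, -, -, -, hz⟩ := he.exists_left_inverse h hx hex hxe hx0
    exact hy0 (by rw [← hey, ← hz, mul_assoc, h0, mul_zero])
  let H : AddSubgroup G :=
    { carrier := {g | ∃ x ∈ 𝒜 g, e * x = x ∧ x * e = x ∧ x ≠ 0}
      add_mem' := by
        rintro g k ⟨x, hx, hex, hxe, hx0⟩ ⟨y, hy, hey, hye, hy0⟩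
        exact ⟨x * y, h.mul_mem _ _ _ _ hx hy, by rw [← mul_assoc, hex], by rw [mul_assoc, hye],
          hmul hx hy hex hxe hey hye hx0 hy0⟩
      zero_mem' := ⟨e, he.mem, he.mul_self, he.mul_self, he.ne_zero⟩
      neg_mem' := by
        rintro g ⟨x, hx, hex, hxe, hx0⟩
        obtain ⟨y, hy, hey, hye, hyx⟩ := he.exists_left_inverse h hx hex hxe hx0
        refine ⟨y, hy, hey, hye, ?_⟩
        rintro rfl
        exact he.ne_zero (by rw [← hyx, zero_mul]) }
  obtain ⟨γ, hγ⟩ := IsAddCyclic.exists_generator (α := H)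
  obtain ⟨x, hx, hex, hxe, hx0⟩ := γ.2
  -- Powers must start at `e`, since the algebra has no unit; only the recursion is kept.
  have hpow : ∃ pow : A → ℕ → A, ∀ x, pow x 0 = e ∧ ∀ n, pow x (n + 1) = pow x n * x :=
    ⟨fun x n => Nat.rec e (fun _ y => y * x) n, fun x => ⟨rfl, fun n => rfl⟩⟩
  obtain ⟨pow, hpow⟩ := hpow
  have hpow0 := fun x => (hpow x).1
  have hpows := fun x => (hpow x).2
  have hpm : ∀ {x : A}, x ∈ 𝒜 γ → x * e = x → e * x = x → ∀ n : ℕ, pow x n ∈ 𝒜 ((n • γ : H) : G) ∧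
      e * pow x n = pow x n ∧ pow x n * e = pow x n := by
    intro x hx hxe hex n
    induction n with
    | zero => simpa [hpow0, he.mul_self] using he.mem
    | succ n ih =>
      rw [hpows]
      refine ⟨?_, by rw [← mul_assoc, ih.2.1], by rw [mul_assoc, hxe]⟩
      rw [succ_nsmul]
      exact h.mul_mem _ _ _ _ ih.1 hx
  have hsmul : ∀ (c : F) (n : ℕ), pow (c • x) n = c ^ n • pow x n := by
    intro c n
    induction n with
    | zero => simp [hpow0]
    | succ n ih => rw [hpows, hpows, ih, smul_mul_assoc, mul_smul_comm, smul_smul, pow_succ]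
  have hpne : ∀ {x : A}, x ∈ 𝒜 γ → x * e = x → e * x = x → x ≠ 0 → ∀ n : ℕ, pow x n ≠ 0 := by
    intro x hx hxe hex hx0 n
    induction n with
    | zero => rw [hpow0]; exact he.ne_zero
    | succ n ih =>
      rw [hpows]
      have := hpm hx hxe hex n
      exact hmul this.1 hx this.2.1 this.2.2 hex hxe ih hx0
  let N := addOrderOf γ
  have hN : 0 < N := addOrderOf_pos γ
  obtain ⟨c, hc⟩ : ∃ c : F, pow x N = c • e := by
    have := hpm hx hxe hex N
    refine he.exists_eq_smul h ?_ this.2.1 this.2.2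
    simpa [N, addOrderOf_nsmul_eq_zero] using this.1
  have hc0 : c ≠ 0 := by
    rintro rfl
    exact hpne hx hxe hex hx0 N (by rw [hc, zero_smul])
  -- Scaling `x` by an `N`-th root of `c⁻¹` turns its `N`-th power into `e`; this is what
  -- trivialises the cocycle.
  obtain ⟨r, hr⟩ := IsAlgClosed.exists_pow_nat_eq c⁻¹ hN
  have hr0 : r ≠ 0 := by
    rintro rfl
    rw [zero_pow hN.ne'] at hr
    exact inv_ne_zero hc0 hr.symm
  have hy : r • x ∈ 𝒜 γ := Submodule.smul_mem _ _ hx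
  have hye : r • x * e = r • x := by rw [smul_mul_assoc, hxe]
  have hey : e * r • x = r • x := by rw [mul_smul_comm, hex]
  have hy0 : r • x ≠ 0 := smul_ne_zero hr0 hx0
  have hyN : pow (r • x) N = e := by rw [hsmul, hr, hc, smul_smul, inv_mul_cancel₀ hc0, one_smul]
  generalize r • x = y at hy hye hey hy0 hyN
  have hadd : ∀ m n : ℕ, pow y (m + n) = pow y m * pow y n := by
    intro m n
    induction n with
    | zero => rw [add_zero, hpow0, (hpm hy hye hey m).2.2]
    | succ n ih => rw [← add_assoc, hpows, hpows, ih, mul_assoc]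
  have hmulN : ∀ q : ℕ, pow y (N * q) = e := by
    intro q
    induction q with
    | zero => rw [mul_zero, hpow0]
    | succ q ih => rw [mul_add, mul_one, hadd, ih, hyN, he.mul_self]
  have hmod : ∀ n : ℕ, pow y n = pow y (n % N) := by
    intro n
    conv_lhs => rw [← Nat.mod_add_div n N, hadd, hmulN, (hpm hy hye hey _).2.2]
  have hsurj : ∀ ξ : H, ∃ n : ℕ, n • γ = ξ := fun ξ => by
    have := hγ ξ
    rw [← mem_multiples_iff_mem_zmultiples] at this
    exact this
  choose i hi using hsurj
  -- The chosen exponent `i ξ` matters only modulo `N`, so additivity in `ξ` follows from additivity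
  -- of exponents.
  have key : ∀ n : ℕ, pow y (i (n • γ)) = pow y n := by
    intro n
    rw [hmod, hmod n]
    congr 1
    exact nsmul_eq_nsmul_iff_modEq.1 (hi (n • γ))
  refine ⟨H, fun ξ => pow y (i ξ), ?_, ?_, ?_, he.ne_zero, ?_⟩
  · intro ξ
    have := (hpm hy hye hey (i ξ)).1
    rwa [hi] at this
  · have := key 0
    rwa [zero_smul, hpow0] at this
  · intro ξ ξ'
    have := key (i ξ + i ξ')
    rw [add_smul, hi, hi] at this
    rw [this, hadd]
  · intro g z hz hez hze hz0
    let ξ : H := ⟨g, z, hz, hez, hze, hz0⟩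
    have hpξ := hpm hy hye hey (i ξ)
    rw [hi] at hpξ
    have hpξ0 := hpne hy hye hey hy0 (i ξ)
    obtain ⟨w, hw, hew, hwe, hwp, hpw⟩ := he.exists_inverse h hpξ.1 hpξ.2.1 hpξ.2.2 hpξ0
    obtain ⟨c, hc⟩ : ∃ c : F, w * z = c • e := by
      refine he.exists_eq_smul h ?_ (by rw [← mul_assoc, hew]) (by rw [mul_assoc, hze])
      simpa [ξ] using h.mul_mem _ _ _ _ hw hz
    have hz' : z = c • pow y (i ξ) := by
      rw [← hez, ← hpw, mul_assoc, hc, mul_smul_comm, hpξ.2.2]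
    refine ⟨ξ, c, rfl, ?_, hz'⟩
    rintro rfl
    exact hz0 (by rw [hz', zero_smul])

end IsMinimalIdempotent

namespace IsGroupCorner

variable {H : AddSubgroup G} {η : H → A}

theorem e_mul (hη : IsGroupCorner 𝒜 H e η) (ξ : H) : e * η ξ = η ξ := by
  rw [← hη.zero, hη.mul, zero_add]

theorem mul_e (hη : IsGroupCorner 𝒜 H e η) (ξ : H) : η ξ * e = η ξ := by
  rw [← hη.zero, hη.mul, add_zero]

theorem e_mul_e (hη : IsGroupCorner 𝒜 H e η) : e * e = e := by
  nth_rw 2 [← hη.zero]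
  rw [hη.e_mul, hη.zero]

theorem e_mem (hη : IsGroupCorner 𝒜 H e η) : e ∈ 𝒜 0 := by
  simpa [hη.zero] using hη.mem 0

theorem apply_ne_zero (hη : IsGroupCorner 𝒜 H e η) (ξ : H) : η ξ ≠ 0 := by
  intro h0
  apply hη.ne_zero
  rw [← hη.zero, ← add_neg_cancel ξ, ← hη.mul, h0, zero_mul]

theorem exists_eq_smul (hη : IsGroupCorner 𝒜 H e η) {ξ : H} {x : A} (hx : x ∈ 𝒜 ξ)
    (hex : e * x = x) (hxe : x * e = x) : ∃ c : F, x = c • η ξ := by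
  by_cases hx0 : x = 0
  · exact ⟨0, by rw [hx0, zero_smul]⟩
  · obtain ⟨ξ', c, h1, -, h2⟩ := hη.exists_eq _ x hx hex hxe hx0
    obtain rfl : ξ' = ξ := Subtype.ext h1
    exact ⟨c, h2⟩

theorem exists_inverse [IsScalarTower F A A] [SMulCommClass F A A] (hη : IsGroupCorner 𝒜 H e η)
    {g : G} {x : A} (hx : x ∈ 𝒜 g) (hex : e * x = x) (hxe : x * e = x) (hx0 : x ≠ 0) :
    ∃ y ∈ 𝒜 (-g), e * y = y ∧ y * x = e := by
  obtain ⟨ξ, c, rfl, hc, rfl⟩ := hη.exists_eq _ x hx hex hxe hx0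
  refine ⟨c⁻¹ • η (-ξ), Submodule.smul_mem _ _ (by simpa using hη.mem (-ξ)), ?_, ?_⟩
  · rw [mul_smul_comm, hη.e_mul]
  · rw [smul_mul_smul_comm, hη.mul, inv_mul_cancel₀ hc, one_smul, neg_add_cancel, hη.zero]

theorem linearIndependent (hη : IsGroupCorner 𝒜 H e η) (h : IsAlgGrading 𝒜) :
    LinearIndependent F η := by
  rw [linearIndependent_iff']
  intro s c hc ξ hξ
  have := congrArg (h.proj (ξ : G)) hc
  rw [map_sum, map_zero, Finset.sum_eq_single ξ] at this
  · rw [h.proj_self (Submodule.smul_mem _ _ (hη.mem ξ))] at this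
    exact (smul_eq_zero.1 this).resolve_right (hη.apply_ne_zero ξ)
  · intro ξ' _ hne
    exact h.proj_ne (Submodule.smul_mem _ _ (hη.mem ξ')) fun h' => hne (Subtype.ext h'.symm)
  · exact fun h' => absurd hξ h'

theorem mem_span [Fintype G] [IsScalarTower F A A] [SMulCommClass F A A]
    (hη : IsGroupCorner 𝒜 H e η) (h : IsAlgGrading 𝒜) {x : A}
    (hex : e * x = x) (hxe : x * e = x) : x ∈ Submodule.span F (Set.range η) := by
  rw [← h.sum_proj x]
  refine Submodule.sum_mem _ fun g _ => ?_
  by_cases hg : h.proj g x = 0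
  · rw [hg]
    exact Submodule.zero_mem _
  · obtain ⟨ξ, c, -, -, hc⟩ := hη.exists_eq g _ (h.proj_mem g x)
      (by rw [← h.proj_mul_left hη.e_mem, zero_add, hex])
      (by rw [← h.proj_mul_right hη.e_mem, add_zero, hxe]) hg
    rw [hc]
    exact Submodule.smul_mem _ _ (Submodule.subset_span ⟨ξ, rfl⟩)

end IsGroupCorner

theorem IsGradedSimple.exists_isGroupCorner [Finite G] [IsScalarTower F A A] [SMulCommClass F A A]
    [FiniteDimensional F A] [IsAlgClosed F] [IsAddCyclic G]
    (hS : IsGradedSimple 𝒜) (h : IsAlgGrading 𝒜) :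
    ∃ (H : AddSubgroup G) (e : A) (η : H → A), IsGroupCorner 𝒜 H e η := by
  have := Fintype.ofFinite G
  obtain ⟨e, he, he0, hee, hinv⟩ := hS.exists_idempotent h
  obtain ⟨H, η, hη⟩ := IsMinimalIdempotent.exists_isGroupCorner ⟨he, he0, hee, hinv⟩ h
  exact ⟨H, e, η, hη⟩

end Corner

/-! ### Frames and matrix units -/

/-- The trivial 2-cocycle. -/
def trivialTwoCocycle (L F : Type*) [AddCommGroup L] [Field F] : TwoCocycle L F where
  toFun _ _ := 1
  cocycle _ _ _ := rfl

section Frames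

variable {F G A : Type*} [Field F] [AddCommGroup G] [NonUnitalRing A] [Module F A]

open Classical in
/-- Homogeneous elements `v i` of `A e` and `w i` of `e A` with `w i * v j = δ i j • e`. -/
structure IsPartialFrame (𝒜 : G → Submodule F A) (e : A) {ι : Type*} (θ : ι → G) (v w : ι → A) :
    Prop where
  v_mem : ∀ i, v i ∈ 𝒜 (-θ i)
  w_mem : ∀ i, w i ∈ 𝒜 (θ i)
  v_mul_e : ∀ i, v i * e = v i
  e_mul_w : ∀ i, e * w i = w i
  w_mul_v : ∀ i j, w i * v j = if i = j then e else 0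

/-- A partial frame such that `∑ i, v i * w i` is the identity of `A e`. -/
structure IsFrame (𝒜 : G → Submodule F A) (e : A) {ι : Type*} [Fintype ι] (θ : ι → G)
    (v w : ι → A) : Prop extends IsPartialFrame 𝒜 e θ v w where
  sum_mul : ∀ x, x * e = x → ∑ i, v i * (w i * x) = x

variable {𝒜 : G → Submodule F A} {e : A} {H : AddSubgroup G} {η : H → A}

namespace IsPartialFrame

variable {ι : Type*} {θ : ι → G} {v w : ι → A}

theorem w_mul_v_self (hf : IsPartialFrame 𝒜 e θ v w) (i : ι) : w i * v i = e := by
  simp [hf.w_mul_v]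

theorem w_mul_v_ne (hf : IsPartialFrame 𝒜 e θ v w) {i j : ι} (hij : i ≠ j) : w i * v j = 0 := by
  simp [hf.w_mul_v, hij]

theorem w_mul_sum [Fintype ι] (hf : IsPartialFrame 𝒜 e θ v w) (x : A) (i : ι) :
    w i * ∑ j, v j * (w j * x) = w i * x := by
  classical
  rw [Finset.mul_sum, Finset.sum_eq_single i]
  · rw [← mul_assoc, hf.w_mul_v_self, ← mul_assoc, hf.e_mul_w]
  · intro j _ hj
    rw [← mul_assoc, hf.w_mul_v_ne hj.symm, zero_mul]
  · simp

theorem sum_mul_v [Fintype ι] (hf : IsPartialFrame 𝒜 e θ v w) (x : A) (i : ι) :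
    (∑ j, x * v j * w j) * v i = x * v i := by
  classical
  rw [Finset.sum_mul, Finset.sum_eq_single i]
  · rw [mul_assoc, hf.w_mul_v_self, mul_assoc, hf.v_mul_e]
  · intro j _ hj
    rw [mul_assoc, hf.w_mul_v_ne hj, mul_zero]
  · simp

theorem linearIndependent [SMulCommClass F A A] [Finite ι] (hf : IsPartialFrame 𝒜 e θ v w)
    (he : e ≠ 0) :
    LinearIndependent F v := by
  classical
  have := Fintype.ofFinite ι
  rw [Fintype.linearIndependent_iff]
  intro c hc i
  have := congrArg (w i * ·) hc
  simp only [Finset.mul_sum, mul_zero] at this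
  rw [Finset.sum_eq_single i] at this
  · rw [mul_smul_comm, hf.w_mul_v_self] at this
    exact (smul_eq_zero.1 this).resolve_right he
  · intro j _ hj
    rw [mul_smul_comm, hf.w_mul_v_ne hj.symm, smul_zero]
  · simp

/-- A vector outside the span of the frame is corrected to a homogeneous `y` killed by every `w i`.
Primeness gives a functional on `y` that is nonzero, and correcting it to kill every `v i` does not
change its value there. That value is invertible in the corner, so normalising yields the new dual
pair. -/
theorem exists_option [IsScalarTower F A A] [SMulCommClass F A A] [Fintype G] [Fintype ι]
    (hf : IsPartialFrame 𝒜 e θ v w)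
    (hS : IsGradedSimple 𝒜) (h : IsAlgGrading 𝒜) (hη : IsGroupCorner 𝒜 H e η)
    (hn : ¬ ∀ x, x * e = x → ∑ i, v i * (w i * x) = x) :
    ∃ (θ' : Option ι → G) (v' w' : Option ι → A), IsPartialFrame 𝒜 e θ' v' w' := by
  classical
  have hvw : ∀ i, v i * w i ∈ 𝒜 0 := fun i => by
    simpa using h.mul_mem _ _ _ _ (hf.v_mem i) (hf.w_mem i)
  have hP : ∀ g, ∀ x ∈ 𝒜 g, ∑ i, v i * (w i * x) ∈ 𝒜 g := fun g x hx =>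
    Submodule.sum_mem _ fun i _ => by
      simpa [mul_assoc] using h.mul_mem _ _ _ _ (hvw i) hx
  have hQ : ∀ g, ∀ x ∈ 𝒜 g, ∑ i, x * v i * w i ∈ 𝒜 g := fun g x hx =>
    Submodule.sum_mem _ fun i _ => by
      simpa [mul_assoc] using h.mul_mem _ _ _ _ hx (hvw i)
  obtain ⟨g, x, hx, hxe, hx0⟩ : ∃ g, ∃ x ∈ 𝒜 g, x * e = x ∧ ∑ i, v i * (w i * x) ≠ x := by
    by_contra! hc
    refine hn fun x hxe => ?_
    rw [← h.sum_proj x]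
    simp only [Finset.mul_sum]
    rw [Finset.sum_comm]
    refine Finset.sum_congr rfl fun g _ => hc g _ (h.proj_mem g x) ?_
    rw [← h.proj_mul_right hη.e_mem, add_zero, hxe]
  let y := x - ∑ i, v i * (w i * x)
  have hy : y ∈ 𝒜 g := Submodule.sub_mem _ hx (hP g x hx)
  have hy0 : y ≠ 0 := sub_ne_zero.2 hx0.symm
  have hye : y * e = y := by simp only [y, sub_mul, Finset.sum_mul, mul_assoc, hxe]
  have hwy : ∀ i, w i * y = 0 := fun i => by
    simp only [y, mul_sub, hf.w_mul_sum, sub_self]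
  obtain ⟨k, c, hc, hecy⟩ := hS.exists_mul_mul_ne_zero h hy hy0 hη.ne_zero
  let z := e * c - ∑ i, e * c * v i * w i
  have hec : e * c ∈ 𝒜 k := by simpa using h.mul_mem _ _ _ _ hη.e_mem hc
  have hz : z ∈ 𝒜 k := Submodule.sub_mem _ hec (hQ k _ hec)
  have hez : e * z = z := by
    simp only [z, mul_sub, Finset.mul_sum, ← mul_assoc, hη.e_mul_e]
  have hzv : ∀ i, z * v i = 0 := fun i => by
    simp only [z, sub_mul, hf.sum_mul_v, sub_self]
  have hzy : z * y = e * c * y := by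
    simp only [z, sub_mul, Finset.sum_mul, mul_assoc, hwy, mul_zero, Finset.sum_const_zero,
      sub_zero]
  obtain ⟨d, hd, hed, hdz⟩ := hη.exists_inverse (h.mul_mem _ _ _ _ hz hy)
    (by rw [← mul_assoc, hez]) (by rw [mul_assoc, hye]) (hzy ▸ hecy)
  refine ⟨fun o => o.elim (-g) θ, fun o => o.elim y v, fun o => o.elim (d * z) w, ?_, ?_, ?_, ?_,
    ?_⟩
  · rintro (_ | i)
    · simpa using hy
    · exact hf.v_mem i
  · rintro (_ | i)
    · have := h.mul_mem _ _ _ _ hd hz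
      rwa [show -(k + g) + k = -g by abel] at this
    · exact hf.w_mem i
  · rintro (_ | i)
    · exact hye
    · exact hf.v_mul_e i
  · rintro (_ | i)
    · change e * (d * z) = d * z
      rw [← mul_assoc, hed]
    · exact hf.e_mul_w i
  · rintro (_ | i) (_ | j)
    · simpa [mul_assoc] using hdz
    · simp [mul_assoc, hzv]
    · simp [hwy]
    · simp [hf.w_mul_v]

end IsPartialFrame

/-- If every partial frame could be enlarged, the independent vectors `v i` would outnumber the
dimension. -/
theorem IsGradedSimple.exists_isFrame [Finite G] [IsScalarTower F A A] [SMulCommClass F A A]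
    [FiniteDimensional F A] (hS : IsGradedSimple 𝒜) (h : IsAlgGrading 𝒜)
    (hη : IsGroupCorner 𝒜 H e η) :
    ∃ (ι : Type) (_ : Fintype ι) (θ : ι → G) (v w : ι → A), IsFrame 𝒜 e θ v w := by
  have := Fintype.ofFinite G
  by_contra! hn
  have key : ∀ n : ℕ, ∃ (ι : Type) (_ : Fintype ι) (θ : ι → G) (v w : ι → A),
      Fintype.card ι = n ∧ IsPartialFrame 𝒜 e θ v w := by
    intro n
    induction n with
    | zero =>
      exact ⟨Empty, inferInstance, Empty.elim, Empty.elim, Empty.elim, rfl,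
        by constructor <;> rintro ⟨⟩⟩
    | succ n ih =>
      obtain ⟨ι, _, θ, v, w, hι, hf⟩ := ih
      obtain ⟨θ', v', w', hf'⟩ := hf.exists_option hS h hη
        fun hs => hn ι inferInstance θ v w ⟨hf, hs⟩
      exact ⟨Option ι, inferInstance, θ', v', w', by simp [hι], hf'⟩
  obtain ⟨ι, _, θ, v, w, hι, hf⟩ := key (Module.finrank F A + 1)
  have := (hf.linearIndependent (F := F) hη.ne_zero).fintype_card_le_finrank
  omega

namespace IsFrame

theorem reindex {ι κ : Type*} [Fintype ι] [Fintype κ] {θ : ι → G} {v w : ι → A}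
    (hf : IsFrame 𝒜 e θ v w) (f : κ ≃ ι) : IsFrame 𝒜 e (θ ∘ f) (v ∘ f) (w ∘ f) where
  v_mem i := hf.v_mem (f i)
  w_mem i := hf.w_mem (f i)
  v_mul_e i := hf.v_mul_e (f i)
  e_mul_w i := hf.e_mul_w (f i)
  w_mul_v i j := by
    rcases eq_or_ne i j with rfl | hij
    · simp [hf.w_mul_v_self]
    · simpa [hij] using hf.w_mul_v_ne (f.injective.ne hij)
  sum_mul x hx := (f.sum_comp fun i => v i * (w i * x)).trans (hf.sum_mul x hx)

variable [IsScalarTower F A A] [SMulCommClass F A A]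

section

variable {ι : Type*} [Fintype ι] {θ : ι → G} {v w : ι → A}

/-- By primeness `A` acts faithfully on `A e`, so `∑ i, v i * w i`, being the identity on `A e`, is
a left unit of `A`. -/
theorem sum_mul_eq [Fintype G] (hf : IsFrame 𝒜 e θ v w) (hS : IsGradedSimple 𝒜)
    (h : IsAlgGrading 𝒜) (hη : IsGroupCorner 𝒜 H e η) (x : A) : ∑ i, v i * (w i * x) = x := by
  rw [← sub_eq_zero]
  refine hS.eq_zero_of_forall_mul_mul h hη.e_mem hη.ne_zero fun c => ?_
  have := hf.sum_mul (x * c * e) (by rw [mul_assoc, hη.e_mul_e])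
  simp only [sub_mul, Finset.sum_mul, mul_assoc] at this ⊢
  rw [this, sub_self]

theorem sum_mul_eq' [Fintype G] (hf : IsFrame 𝒜 e θ v w) (hS : IsGradedSimple 𝒜)
    (h : IsAlgGrading 𝒜) (hη : IsGroupCorner 𝒜 H e η) (x : A) : ∑ i, x * v i * w i = x := by
  rw [← sub_eq_zero]
  refine hS.eq_zero_of_forall_mul_mul h hη.e_mem hη.ne_zero fun c => ?_
  have := congrArg (x * ·) (hf.sum_mul (c * e) (by rw [mul_assoc, hη.e_mul_e]))
  simp only [sub_mul, Finset.sum_mul, Finset.mul_sum, mul_assoc] at this ⊢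
  rw [this, sub_self]

end

variable {k : ℕ} {θ : Fin k → G} {v w : Fin k → A}

/-- The isomorphism from the matrix algebra that maps `E_{ij} η_ξ` to `v i * η ξ * w j`. -/
theorem exists_linearEquiv [Fintype G] (hf : IsFrame 𝒜 e θ v w) (hS : IsGradedSimple 𝒜)
    (h : IsAlgGrading 𝒜) (hη : IsGroupCorner 𝒜 H e η) :
    ∃ φ : TwistedMatrix (trivialTwoCocycle H F) k ≃ₗ[F] A,
      (∀ M N, φ (M * N) = φ M * φ N) ∧
      ∀ i j ξ, φ (basisElt _ i j ξ) = v i * η ξ * w j := by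
  classical
  let ζ := trivialTwoCocycle H F
  let ρ : TwistedGroupAlgebra ζ →ₗ[F] A := (TwistedGroupAlgebra.basis ζ).constr F η
  have hρη : ∀ ξ, ρ (TwistedGroupAlgebra.η ζ ξ) = η ξ := fun ξ =>
    (TwistedGroupAlgebra.basis ζ).constr_basis F η ξ
  have hρmul : ∀ a b, ρ (a * b) = ρ a * ρ b := by
    intro a b
    induction a using TwistedGroupAlgebra.induction_on with
    | h0 => simp
    | hadd a a' h h' => rw [add_mul, map_add, map_add, add_mul, h, h']
    | hη r x =>
      induction b using TwistedGroupAlgebra.induction_on with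
      | h0 => simp
      | hadd b b' h h' => rw [mul_add, map_add, map_add, mul_add, h, h']
      | hη s y =>
        rw [smul_mul_smul_comm, TwistedGroupAlgebra.η_mul_η, map_smul, map_smul, map_smul,
          map_smul, hρη, hρη, hρη, smul_mul_smul_comm, hη.mul]
        simp [ζ, trivialTwoCocycle]
  have hρe : ∀ a, e * ρ a = ρ a ∧ ρ a * e = ρ a := by
    intro a
    induction a using TwistedGroupAlgebra.induction_on with
    | h0 => simp
    | hadd a a' h h' =>
      rw [map_add, mul_add, add_mul, h.1, h'.1, h.2, h'.2]
      exact ⟨rfl, rfl⟩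
    | hη r x =>
      rw [map_smul, mul_smul_comm, smul_mul_assoc, hρη, hη.e_mul, hη.mul_e]
      exact ⟨rfl, rfl⟩
  have hρinj : Function.Injective ρ := by
    intro a b hab
    have hρ : ∀ a, ρ a = Finsupp.linearCombination F η ((TwistedGroupAlgebra.basis ζ).repr a) :=
      fun a => by rw [Module.Basis.constr_apply, Finsupp.linearCombination_apply]
    rw [hρ, hρ] at hab
    exact (TwistedGroupAlgebra.basis ζ).repr.injective (hη.linearIndependent h hab)
  have hρsurj : ∀ x, e * x = x → x * e = x → ∃ a, ρ a = x := by
    intro x h1 h2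
    have := hη.mem_span h h1 h2
    rwa [← (TwistedGroupAlgebra.basis ζ).constr_range F] at this
  let φ : TwistedMatrix ζ k →ₗ[F] A :=
    { toFun := fun M => ∑ i, ∑ j, v i * ρ (M i j) * w j
      map_add' := fun M N => by
        simp only [Matrix.add_apply, map_add, mul_add, add_mul, Finset.sum_add_distrib]
      map_smul' := fun c M => by
        simp only [Matrix.smul_apply, map_smul, mul_smul_comm, smul_mul_assoc, Finset.smul_sum,
          RingHom.id_apply] }
  have hφ : ∀ M, φ M = ∑ i, ∑ j, v i * ρ (M i j) * w j := fun M => rfl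
  -- The entries of `M` are recovered by sandwiching `φ M` between `w a` and `v b`; injectivity and
  -- multiplicativity are then checked entrywise.
  have hwφ : ∀ M a b, w a * φ M * v b = ρ (M a b) := by
    intro M a b
    rw [hφ, Finset.mul_sum, Finset.sum_mul, Finset.sum_eq_single a, Finset.mul_sum,
      Finset.sum_mul, Finset.sum_eq_single b]
    · rw [mul_assoc, mul_assoc, hf.w_mul_v_self, ← mul_assoc, ← mul_assoc, hf.w_mul_v_self,
        (hρe _).1, (hρe _).2]
    · intro j _ hj
      rw [mul_assoc, mul_assoc, hf.w_mul_v_ne hj, mul_zero, mul_zero]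
    · simp
    · intro i _ hi
      have : ∀ z, w a * (v i * z) = 0 := fun z => by
        rw [← mul_assoc, hf.w_mul_v_ne hi.symm, zero_mul]
      simp [Finset.mul_sum, mul_assoc, this]
    · simp
  have hinj : Function.Injective φ := by
    intro M N hMN
    ext a b
    apply hρinj
    rw [← hwφ, ← hwφ, hMN]
  have hexp : ∀ x, ∑ i, ∑ j, v i * (w i * x * v j) * w j = x := by
    intro x
    conv_rhs => rw [← hf.sum_mul_eq hS h hη x]
    refine Finset.sum_congr rfl fun i _ => ?_
    rw [← hf.sum_mul_eq' hS h hη (v i * (w i * x))]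
    simp only [mul_assoc]
  have hsurj : Function.Surjective φ := by
    intro x
    have : ∀ i j, ∃ a, ρ a = w i * x * v j := fun i j => by
      refine hρsurj _ ?_ ?_
      · rw [← mul_assoc, ← mul_assoc, hf.e_mul_w]
      · rw [mul_assoc, hf.v_mul_e]
    choose M hM using this
    exact ⟨Matrix.of M, by simp only [hφ, Matrix.of_apply, hM, hexp]⟩
  have hbij : Function.Bijective φ := ⟨hinj, hsurj⟩
  refine ⟨LinearEquiv.ofBijective φ hbij, ?_, ?_⟩
  · intro M N
    simp only [LinearEquiv.ofBijective_apply]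
    have hsep : ∀ x y, (∀ a b, w a * x * v b = w a * y * v b) → x = y := by
      intro x y hxy
      rw [← hexp x, ← hexp y]
      simp only [hxy]
    refine hsep _ _ fun a b => ?_
    rw [hwφ, Matrix.mul_apply, map_sum]
    simp only [hρmul, ← hwφ]
    have := congrArg (w a * φ M * ·) (hf.sum_mul_eq hS h hη (φ N * v b))
    simp only [Finset.mul_sum] at this
    simp only [mul_assoc] at this ⊢
    exact this
  · intro i j ξ
    rw [LinearEquiv.ofBijective_apply, hφ, Finset.sum_eq_single i, Finset.sum_eq_single j]
    · simp [basisElt, hρη, ζ]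
    · intro b _ hb
      simp [basisElt, hb.symm]
    · simp
    · intro a _ ha
      simp [basisElt, ha.symm]
    · simp

end IsFrame

end Frames

/-! ### Frames adapted to a graded involution -/

section StarFrames

variable {F G A : Type*} [Field F] [AddCommGroup G] [NonUnitalRing A] [Module F A]
  {𝒜 : G → Submodule F A} {e : A} {H : AddSubgroup G} {η : H → A} {σ : A →ₗ[F] A}

/-- Mutually inverse homogeneous elements `t` of `σ e * A * e` and `u` of `e * A * σ e`. The form
`(x, y) ↦ u * σ x * y` on `A e` takes its values in `e A e`. -/
structure IsStarCorner (𝒜 : G → Submodule F A) (e : A) {H : AddSubgroup G} (η : H → A)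
    (σ : A →ₗ[F] A) (d : G) (t u : A) : Prop where
  t_mem : t ∈ 𝒜 d
  u_mem : u ∈ 𝒜 (-d)
  t_mul_e : t * e = t
  e_mul_u : e * u = u
  u_mul_t : u * t = e
  t_mul_u : t * u = σ e
  map_t_u : ∃ δ : F, δ * δ = 1 ∧ σ t = δ • t ∧ σ u = δ • u
  map_η : ∀ ξ, ∃ χ : F, χ * χ = 1 ∧ σ (η ξ) = χ • (t * η ξ * u)

/-- A finite family of homogeneous elements of `A e` that is orthogonal for the form of a corner,
up to an involution `i ↦ inv i` of the index set. -/
structure IsStarSystem (𝒜 : G → Submodule F A) (e : A) {H : AddSubgroup G} (η : H → A)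
    (σ : A →ₗ[F] A) (t : A) {ι : Type*} (θ : ι → G) (v : ι → A) (inv : ι → ι) (a : ι → H)
    (s : ι → F) : Prop where
  v_mem : ∀ i, v i ∈ 𝒜 (-θ i)
  v_mul_e : ∀ i, v i * e = v i
  inv_inv : ∀ i, inv (inv i) = i
  s_mul_s : ∀ i, s i * s i = 1
  star_v_mul_v_inv : ∀ i, σ (v i) * v (inv i) = s i • (t * η (a i))
  star_v_mul_v_ne : ∀ i j, j ≠ inv i → σ (v i) * v j = 0

/-- Primeness provides a nonzero homogeneous `t` in `σ e * A * e`, and primeness again gives an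
inverse `u` relative to the corner. Each homogeneous piece involved is a line preserved by `σ`, up
to conjugation by `t`, so `σ` acts on it by a scalar; since `σ` is an involution, the scalar has
square one. -/
theorem IsGradedSimple.exists_isStarCorner [Fintype G] [IsScalarTower F A A] [SMulCommClass F A A]
    (hS : IsGradedSimple 𝒜) (h : IsAlgGrading 𝒜) (hη : IsGroupCorner 𝒜 H e η)
    (hσ : IsGradedInvolution 𝒜 σ) : ∃ d t u, IsStarCorner 𝒜 e η σ d t u := by
  have hse : σ e ∈ 𝒜 0 := hσ.map_mem _ _ hη.e_mem
  have hse0 : σ e ≠ 0 := fun h0 => hη.ne_zero (by rw [← hσ.involutive e, h0, map_zero])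
  have hsee : σ e * σ e = σ e := by rw [← hσ.map_mul, hη.e_mul_e]
  obtain ⟨d, c, hc, ht0⟩ := hS.exists_mul_mul_ne_zero h hη.e_mem hη.ne_zero hse0
  obtain ⟨t, rfl⟩ : ∃ t, t = σ e * c * e := ⟨_, rfl⟩
  have ht : σ e * c * e ∈ 𝒜 d := by
    simpa using h.mul_mem _ _ _ _ (h.mul_mem _ _ _ _ hse hc) hη.e_mem
  have hte : σ e * c * e * e = σ e * c * e := by rw [mul_assoc, hη.e_mul_e]
  have het : σ e * (σ e * c * e) = σ e * c * e := by rw [← mul_assoc, ← mul_assoc, hsee]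
  generalize σ e * c * e = t at ht0 ht hte het
  obtain ⟨k, b, hb, hb0⟩ := hS.exists_mul_mul_ne_zero h ht ht0 hη.ne_zero
  obtain ⟨y, hy, hey, hyt⟩ := hη.exists_inverse (x := e * b * t)
    (h.mul_mem _ _ _ _ (h.mul_mem _ _ _ _ hη.e_mem hb) ht)
    (by rw [← mul_assoc, ← mul_assoc, hη.e_mul_e]) (by rw [mul_assoc, hte]) hb0
  obtain ⟨u, hu, heu, hue, hut⟩ : ∃ u ∈ 𝒜 (-d), e * u = u ∧ u * σ e = u ∧ u * t = e := by
    refine ⟨y * (e * b) * σ e, ?_, ?_, ?_, ?_⟩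
    · have := h.mul_mem _ _ _ _ (h.mul_mem _ _ _ _ hy (h.mul_mem _ _ _ _ hη.e_mem hb)) hse
      rwa [show -(0 + k + d) + (0 + k) + 0 = -d by abel] at this
    · rw [← mul_assoc, ← mul_assoc, hey]
    · rw [mul_assoc, hsee]
    · rw [mul_assoc, het, mul_assoc, hyt]
  have hsth : σ t ∈ 𝒜 d := hσ.map_mem _ _ ht
  have hste : σ t * e = σ t := by rw [← hσ.involutive e, ← hσ.map_mul, het]
  have hest : σ e * σ t = σ t := by rw [← hσ.map_mul, hte]
  have hsue : σ u * σ e = σ u := by rw [← hσ.map_mul, heu]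
  have hesu : e * σ u = σ u := by rw [← hσ.involutive e, ← hσ.map_mul, hue]
  -- The product `t * u` has degree `0` in `σ e * A * σ e`, which `σ` identifies with the line `F
  -- e`. So it is a multiple of `σ e`, and multiplying by `t` shows that the factor is one.
  have htu : t * u = σ e := by
    obtain ⟨β, hβ⟩ := hη.exists_eq_smul (ξ := 0) (x := σ (t * u))
      (hσ.map_mem _ _ (by simpa using h.mul_mem _ _ _ _ ht hu))
      (by rw [hσ.map_mul, ← mul_assoc, hesu])
      (by rw [hσ.map_mul, mul_assoc, hste])
    rw [hη.zero] at hβ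
    have hβ' : t * u = β • σ e := by rw [← hσ.involutive (t * u), hβ, map_smul]
    have : t = β • t := by
      calc t = t * u * t := by rw [mul_assoc, hut, hte]
        _ = β • t := by rw [hβ', smul_mul_assoc, het]
    have : (β - 1) • t = 0 := by rw [sub_smul, one_smul, ← this, sub_self]
    rw [smul_eq_zero, or_iff_left ht0, sub_eq_zero] at this
    rw [hβ', this, one_smul]
  obtain ⟨δ, hδ⟩ : ∃ δ : F, σ t = δ • t := by
    obtain ⟨δ, hδ⟩ := hη.exists_eq_smul (ξ := 0) (x := u * σ t)
      (by simpa using h.mul_mem _ _ _ _ hu hsth) (by rw [← mul_assoc, heu])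
      (by rw [mul_assoc, hste])
    refine ⟨δ, ?_⟩
    rw [hη.zero] at hδ
    rw [← hest, ← htu, mul_assoc, hδ, mul_smul_comm, hte]
  have hδδ : δ * δ = 1 := by
    have : (δ * δ - 1) • t = 0 := by
      rw [sub_smul, one_smul, mul_smul, ← hδ, ← map_smul, ← hδ, hσ.involutive, sub_self]
    rw [smul_eq_zero, or_iff_left ht0, sub_eq_zero] at this
    exact this
  have hsu : σ u = δ • u := by
    have h1 : δ • (t * σ u) = σ e := by rw [← hut, hσ.map_mul, hδ, smul_mul_assoc]
    calc σ u = e * σ u := hesu.symm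
      _ = u * (t * σ u) := by rw [← mul_assoc, hut]
      _ = (δ * δ) • (u * (t * σ u)) := by rw [hδδ, one_smul]
      _ = δ • (u * δ • (t * σ u)) := by rw [mul_smul_comm, smul_smul]
      _ = δ • u := by rw [h1, hue]
  refine ⟨d, t, u, ht, hu, hte, heu, hut, htu, ⟨δ, hδδ, hδ, hsu⟩, fun ξ => ?_⟩
  obtain ⟨χ, hχ⟩ := hη.exists_eq_smul (ξ := ξ) (x := u * σ (η ξ) * t)
    (by
      have := h.mul_mem _ _ _ _ (h.mul_mem _ _ _ _ hu (hσ.map_mem _ _ (hη.mem ξ))) ht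
      rwa [show -d + (ξ : G) + d = ξ by abel] at this)
    (by rw [← mul_assoc, ← mul_assoc, heu]) (by rw [mul_assoc, hte])
  have h1 : σ (η ξ) = χ • (t * η ξ * u) := by
    calc σ (η ξ) = σ e * σ (η ξ) * σ e := by
          rw [← hσ.map_mul, ← hσ.map_mul, hη.mul_e, hη.e_mul]
      _ = t * (u * σ (η ξ) * t) * u := by rw [← htu]; simp only [mul_assoc]
      _ = χ • (t * η ξ * u) := by rw [hχ, mul_smul_comm, smul_mul_assoc]
  refine ⟨χ, ?_, h1⟩
  have h2 : η ξ = (χ * χ) • η ξ := by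
    calc η ξ = σ (χ • (t * η ξ * u)) := by rw [← h1, hσ.involutive]
      _ = χ • (δ • u * (σ (η ξ) * δ • t)) := by rw [map_smul, hσ.map_mul, hσ.map_mul, hδ, hsu]
      _ = χ • ((δ * δ) • (u * σ (η ξ) * t)) := by
          rw [mul_smul_comm, smul_mul_smul_comm, mul_assoc]
      _ = (χ * χ) • η ξ := by rw [hδδ, one_smul, hχ, smul_smul]
  have : (χ * χ - 1) • η ξ = 0 := by rw [sub_smul, one_smul, ← h2, sub_self]
  rw [smul_eq_zero, or_iff_left (hη.apply_ne_zero ξ), sub_eq_zero] at this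
  exact this

namespace IsStarCorner

variable [SMulCommClass F A A] {d : G} {t u : A}

/-- Multiplying by `u` moves `σ x * y` into the corner, where a nonzero homogeneous element is a
scalar times some `η a`; multiplying by `t` moves it back. -/
theorem exists_eq_smul (hc : IsStarCorner 𝒜 e η σ d t u) (h : IsAlgGrading 𝒜)
    (hη : IsGroupCorner 𝒜 H e η) (hσ : IsGradedInvolution 𝒜 σ) {g k : G} {x y : A}
    (hx : x ∈ 𝒜 g) (hxe : x * e = x) (hy : y ∈ 𝒜 k) (hye : y * e = y) (hxy : σ x * y ≠ 0) :
    ∃ (a : H) (β : F), β ≠ 0 ∧ σ x * y = β • (t * η a) := by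
  have h1 : t * (u * (σ x * y)) = σ x * y := by
    rw [← mul_assoc, hc.t_mul_u, ← mul_assoc, ← hσ.map_mul, hxe]
  obtain ⟨a, β, -, hβ, hβa⟩ := hη.exists_eq _ (u * (σ x * y))
    (h.mul_mem _ _ _ _ hc.u_mem (h.mul_mem _ _ _ _ (hσ.map_mem _ _ hx) hy))
    (by rw [← mul_assoc, hc.e_mul_u]) (by rw [mul_assoc, mul_assoc, hye])
    (fun h0 => hxy (by rw [← h1, h0, mul_zero]))
  exact ⟨a, β, hβ, by rw [← h1, hβa, mul_smul_comm]⟩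

theorem exists_star_eq_smul [IsScalarTower F A A] (hc : IsStarCorner 𝒜 e η σ d t u)
    (hη : IsGroupCorner 𝒜 H e η) (hσ : IsGradedInvolution 𝒜 σ) (a : H) :
    ∃ s : F, s * s = 1 ∧ σ (t * η a) = s • (t * η a) := by
  obtain ⟨δ, hδ, hδt, -⟩ := hc.map_t_u
  obtain ⟨χ, hχ, hχη⟩ := hc.map_η a
  refine ⟨χ * δ, by linear_combination δ * δ * hχ + hδ, ?_⟩
  rw [hσ.map_mul, hδt, hχη, smul_mul_smul_comm, mul_assoc, hc.u_mul_t, mul_assoc, hη.mul_e]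

end IsStarCorner

namespace IsStarSystem

variable [SMulCommClass F A A] {d : G} {t u : A}
  {ι : Type*} {θ : ι → G} {v : ι → A} {inv : ι → ι} {a : ι → H} {s : ι → F}

/-- The Gram matrix is monomial with entries invertible relative to the corner, so the dual basis is
`σ (v (inv i))` divided by the entry that pairs it with `v i`. -/
theorem isPartialFrame [IsScalarTower F A A] (hv : IsStarSystem 𝒜 e η σ t θ v inv a s)
    (hc : IsStarCorner 𝒜 e η σ d t u) (h : IsAlgGrading 𝒜)
    (hη : IsGroupCorner 𝒜 H e η) (hσ : IsGradedInvolution 𝒜 σ) :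
    IsPartialFrame 𝒜 e θ v fun i => s (inv i) • (η (-a (inv i)) * u * σ (v (inv i))) := by
  have hwv : ∀ i, s (inv i) • (η (-a (inv i)) * u * σ (v (inv i))) * v i = e := by
    intro i
    have := hv.star_v_mul_v_inv (inv i)
    rw [hv.inv_inv] at this
    rw [smul_mul_assoc, mul_assoc, this, mul_smul_comm, smul_smul, hv.s_mul_s, one_smul,
      mul_assoc, ← mul_assoc u, hc.u_mul_t, hη.e_mul, hη.mul, neg_add_cancel, hη.zero]
  refine ⟨hv.v_mem, fun i => ?_, hv.v_mul_e, fun i => ?_, fun i j => ?_⟩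
  · have hm := Submodule.smul_mem _ (s (inv i)) (h.mul_mem _ _ _ _
      (h.mul_mem _ _ _ _ (hη.mem (-a (inv i))) hc.u_mem) (hσ.map_mem _ _ (hv.v_mem (inv i))))
    -- The degree of the dual vector is not computed from `d` and `a`. It is forced by the product
    -- with `v i` being the nonzero element `e` of degree `0`.
    have he := h.mul_mem _ _ _ _ hm (hv.v_mem i)
    rw [hwv] at he
    have := h.eq_of_mem_of_mem he hη.e_mem hη.ne_zero
    rw [add_neg_eq_zero] at this
    rwa [this] at hm
  · simp only [mul_smul_comm, ← mul_assoc, hη.e_mul]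
  · split_ifs with hij
    · rw [← hij, hwv]
    · rw [smul_mul_assoc, mul_assoc, hv.star_v_mul_v_ne, mul_zero, smul_zero]
      rw [hv.inv_inv]
      exact Ne.symm hij

theorem star_v (hv : IsStarSystem 𝒜 e η σ t θ v inv a s)
    (hc : IsStarCorner 𝒜 e η σ d t u)
    (hη : IsGroupCorner 𝒜 H e η) (hσ : IsGradedInvolution 𝒜 σ) (i : ι) :
    σ (v i) = s i • (t * η (a i) * (s i • (η (-a i) * u * σ (v i)))) := by
  have : t * η (a i) * (η (-a i) * u * σ (v i)) = σ (v i) := by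
    calc _ = t * (η (a i) * η (-a i)) * u * σ (v i) := by simp only [mul_assoc]
      _ = σ (v i) := by
        rw [hη.mul, add_neg_cancel, hη.zero, hc.t_mul_e, hc.t_mul_u, ← hσ.map_mul, hv.v_mul_e]
  rw [mul_smul_comm, smul_smul, hv.s_mul_s, one_smul, this]

/-- The involution permutes the elements `v i * η ξ * w j` up to signs. -/
theorem star_elementary [IsScalarTower F A A] (hv : IsStarSystem 𝒜 e η σ t θ v inv a s)
    (hc : IsStarCorner 𝒜 e η σ d t u)
    (hη : IsGroupCorner 𝒜 H e η) (hσ : IsGradedInvolution 𝒜 σ) {w : ι → A}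
    (hw : w = fun i => s (inv i) • (η (-a (inv i)) * u * σ (v (inv i)))) (i j : ι) (ξ : H) :
    ∃ ξ' : H, σ (v i * η ξ * w j) = v (inv j) * η ξ' * w (inv i) ∨
      σ (v i * η ξ * w j) = -(v (inv j) * η ξ' * w (inv i)) := by
  obtain ⟨δ, hδ, -, hδu⟩ := hc.map_t_u
  obtain ⟨χ, hχ, hχη⟩ := hc.map_η ξ
  obtain ⟨χ', hχ', hχη'⟩ := hc.map_η (-a (inv j))
  have hsw : σ (w j) = (s (inv j) * (δ * χ')) • (v (inv j) * η (-a (inv j)) * u) := by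
    rw [hw]
    simp only
    rw [map_smul, hσ.map_mul, hσ.map_mul, hσ.involutive, hδu, hχη', smul_mul_smul_comm,
      mul_smul_comm, smul_smul, ← mul_assoc u, ← mul_assoc u, hc.u_mul_t, hη.e_mul,
        ← mul_assoc (v _)]
  have hsv : σ (v i) = s i • (t * η (a i) * w (inv i)) := by
    rw [hw]
    simp only [hv.inv_inv]
    exact hv.star_v hc hη hσ i
  have hprod : v (inv j) * η (-a (inv j)) * u * (t * η ξ * u * (t * η (a i) * w (inv i))) =
      v (inv j) * η (-a (inv j) + ξ + a i) * w (inv i) := by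
    calc _ = v (inv j) * (η (-a (inv j)) * (u * t) * η ξ * (u * t) * η (a i)) * w (inv i) := by
          simp only [mul_assoc]
      _ = _ := by rw [hc.u_mul_t, hη.mul_e, hη.mul, hη.mul_e, hη.mul]
  have hall : σ (v i * η ξ * w j) = (s (inv j) * (δ * χ') * (χ * s i)) •
      (v (inv j) * η (-a (inv j) + ξ + a i) * w (inv i)) := by
    rw [mul_assoc, hσ.map_mul, hσ.map_mul, mul_assoc, hsw, hχη, hsv, smul_mul_smul_comm,
      smul_mul_smul_comm, hprod]
  refine ⟨-a (inv j) + ξ + a i, ?_⟩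
  -- The accumulated scalar is a product of factors with square one, hence a sign.
  have hsq : (s (inv j) * (δ * χ') * (χ * s i)) * (s (inv j) * (δ * χ') * (χ * s i)) = 1 := by
    calc _ = (s (inv j) * s (inv j)) * (δ * δ) * (χ' * χ') * (χ * χ) * (s i * s i) := by ring
      _ = 1 := by simp only [hv.s_mul_s, hδ, hχ, hχ', mul_one]
  rw [hall]
  rcases mul_self_eq_one_iff.1 hsq with h1 | h1
  · left
    rw [h1, one_smul]
  · right
    rw [h1, neg_one_smul]

/-- Gram–Schmidt on the orthogonal complement of the system. Either some homogeneous vector there is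
anisotropic and is added alone, or all are isotropic and two that pair nontrivially are added as a
hyperbolic pair. -/
theorem exists_extension [IsScalarTower F A A] [Fintype G] [IsAlgClosed F] [Fintype ι]
    (hv : IsStarSystem 𝒜 e η σ t θ v inv a s) (hS : IsGradedSimple 𝒜)
    (hc : IsStarCorner 𝒜 e η σ d t u) (h : IsAlgGrading 𝒜)
    (hη : IsGroupCorner 𝒜 H e η) (hσ : IsGradedInvolution 𝒜 σ) {w : ι → A}
    (hw : w = fun i => s (inv i) • (η (-a (inv i)) * u * σ (v (inv i))))
    (hn : ¬ ∀ x, x * e = x → ∑ i, v i * (w i * x) = x) :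
    (∃ (θ' : Option ι → G) (v' : Option ι → A) (inv' : Option ι → Option ι) (a' : Option ι → H)
      (s' : Option ι → F), IsStarSystem 𝒜 e η σ t θ' v' inv' a' s') ∨
    ∃ (θ' : ι ⊕ Bool → G) (v' : ι ⊕ Bool → A) (inv' : ι ⊕ Bool → ι ⊕ Bool) (a' : ι ⊕ Bool → H)
      (s' : ι ⊕ Bool → F), IsStarSystem 𝒜 e η σ t θ' v' inv' a' s' := by
  classical
  have hf : IsPartialFrame 𝒜 e θ v w := hw ▸ hv.isPartialFrame hc h hη hσ
  have hstarv : ∀ i x, w (inv i) * x = 0 → σ (v i) * x = 0 := by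
    intro i x hx
    rw [hw] at hx
    simp only [hv.inv_inv] at hx
    rw [hv.star_v hc hη hσ i, smul_mul_assoc, mul_assoc, hx, mul_zero, smul_zero]
  have hstar0 : ∀ x y, σ x * y = 0 → σ y * x = 0 := by
    intro x y hxy
    rw [← hσ.involutive x, ← hσ.map_mul, hxy, map_zero]
  have hP : ∀ g, ∀ x ∈ 𝒜 g, ∑ i, v i * (w i * x) ∈ 𝒜 g := fun g x hx =>
    Submodule.sum_mem _ fun i _ => by
      simpa using h.mul_mem _ _ _ _ (hf.v_mem i) (h.mul_mem _ _ _ _ (hf.w_mem i) hx)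
  obtain ⟨g, x, hx, hxe, hx0⟩ : ∃ g, ∃ x ∈ 𝒜 g, x * e = x ∧ ∑ i, v i * (w i * x) ≠ x := by
    by_contra! hc
    refine hn fun x hxe => ?_
    rw [← h.sum_proj x]
    simp only [Finset.mul_sum]
    rw [Finset.sum_comm]
    refine Finset.sum_congr rfl fun g _ => hc g _ (h.proj_mem g x) ?_
    rw [← h.proj_mul_right hη.e_mem, add_zero, hxe]
  by_cases hiso : ∃ g, ∃ x ∈ 𝒜 g, x * e = x ∧ (∀ i, σ (v i) * x = 0) ∧ σ x * x ≠ 0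
  · left
    obtain ⟨g, x, hx, hxe, hvx, hxx⟩ := hiso
    obtain ⟨b, β, hβ, hxb⟩ := hc.exists_eq_smul h hη hσ hx hxe hx hxe hxx
    -- Since `σ` is linear, scaling `x` by `r` scales `σ x * x` by `r ^ 2`; the value becomes
    -- exactly `t * η b`, with sign one.
    obtain ⟨r, hr⟩ := IsAlgClosed.exists_pow_nat_eq β⁻¹ (n := 2) (by norm_num)
    have hrr : r * r * β = 1 := by rw [← pow_two, hr, inv_mul_cancel₀ hβ]
    refine ⟨fun o => o.elim (-g) θ, fun o => o.elim (r • x) v, Option.map inv,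
      fun o => o.elim b a, fun o => o.elim 1 s, ?_, ?_, ?_, ?_, ?_, ?_⟩
    · rintro (_ | i)
      · simpa using Submodule.smul_mem _ r hx
      · exact hv.v_mem i
    · rintro (_ | i)
      · simp [smul_mul_assoc, hxe]
      · exact hv.v_mul_e i
    · rintro (_ | i)
      · rfl
      · simp [hv.inv_inv]
    · rintro (_ | i)
      · simp
      · exact hv.s_mul_s i
    · rintro (_ | i)
      · simp [smul_mul_smul_comm, hxb, smul_smul, hrr]
      · exact hv.star_v_mul_v_inv i
    · rintro (_ | i) (_ | j) hij
      · simp at hij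
      · simp [smul_mul_assoc, hstar0 _ _ (hvx j)]
      · simp [mul_smul_comm, hvx]
      · exact hv.star_v_mul_v_ne i j fun h' => hij (by simp [h'])
  · right
    push Not at hiso
    let y := x - ∑ i, v i * (w i * x)
    have hy : y ∈ 𝒜 g := Submodule.sub_mem _ hx (hP g x hx)
    have hy0 : y ≠ 0 := sub_ne_zero.2 hx0.symm
    have hye : y * e = y := by simp only [y, sub_mul, Finset.sum_mul, mul_assoc, hxe]
    have hvy : ∀ i, σ (v i) * y = 0 := fun i => hstarv _ _ (by
      simp only [y, mul_sub, hf.w_mul_sum, sub_self])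
    have hse0 : σ e ≠ 0 := fun h0 => hη.ne_zero (by rw [← hσ.involutive e, h0, map_zero])
    -- The pairing is nondegenerate: a nonzero `σ e * c * y` exhibits `σ c * e` as a partner of `y`
    -- in `A e`. Projecting this partner to the complement leaves its pairing with `y` unchanged.
    obtain ⟨k, c, hck, hecy⟩ := hS.exists_mul_mul_ne_zero h hy hy0 hse0
    have hx' : σ c * e ∈ 𝒜 k := by simpa using h.mul_mem _ _ _ _ (hσ.map_mem _ _ hck) hη.e_mem
    have hxe' : σ c * e * e = σ c * e := by rw [mul_assoc, hη.e_mul_e]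
    have hxy' : σ (σ c * e) * y ≠ 0 := by rwa [hσ.map_mul, hσ.involutive]
    generalize σ c * e = x' at hx' hxe' hxy'
    let z := x' - ∑ i, v i * (w i * x')
    have hz : z ∈ 𝒜 k := Submodule.sub_mem _ hx' (hP k x' hx')
    have hze : z * e = z := by simp only [z, sub_mul, Finset.sum_mul, mul_assoc, hxe']
    have hvz : ∀ i, σ (v i) * z = 0 := fun i => hstarv _ _ (by
      simp only [z, mul_sub, hf.w_mul_sum, sub_self])
    have hzy : σ z * y = σ x' * y := by
      simp only [z, map_sub, map_sum, hσ.map_mul, sub_mul, Finset.sum_mul, mul_assoc, hvy,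
        mul_zero, Finset.sum_const_zero, sub_zero]
    obtain ⟨b, β, hβ, hzb⟩ := hc.exists_eq_smul h hη hσ hz hze hy hye (hzy ▸ hxy')
    obtain ⟨κ, hκ, hκb⟩ := hc.exists_star_eq_smul hη hσ b
    have hy1 : β⁻¹ • y ∈ 𝒜 g := Submodule.smul_mem _ _ hy
    have hye1 : β⁻¹ • y * e = β⁻¹ • y := by rw [smul_mul_assoc, hye]
    have hvy1 : ∀ i, σ (v i) * β⁻¹ • y = 0 := fun i => by rw [mul_smul_comm, hvy, smul_zero]
    have hzy1 : σ z * β⁻¹ • y = t * η b := by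
      rw [mul_smul_comm, hzb, smul_smul, inv_mul_cancel₀ hβ, one_smul]
    generalize β⁻¹ • y = y1 at hy1 hye1 hvy1 hzy1
    have hyz1 : σ y1 * z = κ • (t * η b) := by
      rw [← hκb, ← hzy1, hσ.map_mul, hσ.involutive]
    -- The new indices `false` and `true` carry `y1` and `z` and are swapped by `not`. Only `y1` was
    -- rescaled, so one pairing has sign one and the reversed one has the sign `κ` by which `σ` acts
    -- on `t * η b`.
    refine ⟨Sum.elim θ (Bool.rec (-g) (-k)), Sum.elim v (Bool.rec y1 z), Sum.map inv not,
      Sum.elim a (fun _ => b), Sum.elim s (Bool.rec κ 1), ?_, ?_, ?_, ?_, ?_, ?_⟩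
    · rintro (i | _ | _)
      · exact hv.v_mem i
      · simpa using hy1
      · simpa using hz
    · rintro (i | _ | _)
      · exact hv.v_mul_e i
      · exact hye1
      · exact hze
    · rintro (i | _ | _)
      · simp [hv.inv_inv]
      · rfl
      · rfl
    · rintro (i | _ | _)
      · exact hv.s_mul_s i
      · exact hκ
      · exact one_mul 1
    · rintro (i | _ | _)
      · exact hv.star_v_mul_v_inv i
      · exact hyz1
      · simpa using hzy1
    · rintro (i | _ | _) (j | _ | _) hij
      · exact hv.star_v_mul_v_ne i j fun h' => hij (by simp [h'])
      · exact hvy1 i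
      · exact hvz i
      · exact hstar0 _ _ (hvy1 j)
      · exact hiso g y1 hy1 hye1 hvy1
      · simp at hij
      · exact hstar0 _ _ (hvz j)
      · simp at hij
      · exact hiso k z hz hze hvz

end IsStarSystem

/-- A graded simple algebra with a graded involution has a frame whose matrix units are permuted
by the involution up to signs. -/
theorem IsGradedSimple.exists_isFrame_elementary [Fintype G] [IsScalarTower F A A]
    [SMulCommClass F A A] [FiniteDimensional F A] [IsAlgClosed F] (hS : IsGradedSimple 𝒜)
    (h : IsAlgGrading 𝒜) (hη : IsGroupCorner 𝒜 H e η) (hσ : IsGradedInvolution 𝒜 σ) :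
    ∃ (ι : Type) (_ : Fintype ι) (θ : ι → G) (v w : ι → A), IsFrame 𝒜 e θ v w ∧
      ∀ i j ξ, ∃ i' j' ξ', σ (v i * η ξ * w j) = v i' * η ξ' * w j' ∨
        σ (v i * η ξ * w j) = -(v i' * η ξ' * w j') := by
  obtain ⟨d, t, u, hc⟩ := hS.exists_isStarCorner h hη hσ
  by_contra! hn
  -- Only a lower bound on the size is kept, because an extension may add one vector or two.
  have key : ∀ n : ℕ, ∃ (ι : Type) (_ : Fintype ι) (θ : ι → G) (v : ι → A) (inv : ι → ι)
      (a : ι → H) (s : ι → F), n ≤ Fintype.card ι ∧ IsStarSystem 𝒜 e η σ t θ v inv a s := by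
    intro n
    induction n with
    | zero =>
      exact ⟨Empty, inferInstance, Empty.elim, Empty.elim, Empty.elim, Empty.elim, Empty.elim,
        le_rfl, by constructor <;> rintro ⟨⟩⟩
    | succ n ih =>
      obtain ⟨ι, _, θ, v, inv, a, s, hι, hv⟩ := ih
      have hnc := fun hs => hn ι inferInstance θ v _ ⟨hv.isPartialFrame hc h hη hσ, hs⟩
      have hext := hv.exists_extension hS hc h hη hσ rfl fun hs => by
        obtain ⟨i, j, ξ, hij⟩ := hnc hs
        obtain ⟨ξ', h1 | h1⟩ := hv.star_elementary hc hη hσ rfl i j ξ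
        · exact (hij _ _ ξ').1 h1
        · exact (hij _ _ ξ').2 h1
      obtain ⟨θ', v', inv', a', s', hv'⟩ | ⟨θ', v', inv', a', s', hv'⟩ := hext
      · exact ⟨Option ι, inferInstance, θ', v', inv', a', s', by simp [hι], hv'⟩
      · refine ⟨ι ⊕ Bool, inferInstance, θ', v', inv', a', s', ?_, hv'⟩
        simp only [Fintype.card_sum, Fintype.card_bool]
        omega
  obtain ⟨ι, _, θ, v, inv, a, s, hι, hv⟩ := key (Module.finrank F A + 1)
  have := ((hv.isPartialFrame hc h hη hσ).linearIndependent
    (F := F) hη.ne_zero).fintype_card_le_finrank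
  omega

end StarFrames

/-! ### Transfer along isomorphisms -/

section Transfer

variable {F G A B : Type*} [Field F] [NonUnitalRing A] [Module F A]
  [NonUnitalRing B] [Module F B] {𝒜 : G → Submodule F A} {ℬ : G → Submodule F B}

/-- Transporting the projection of `A` back along `φ` sends each `ℬ k` into `ℬ g`. Since the `ℬ k`
span, this gives the converse inclusion without knowing that they are independent. -/
theorem IsAlgGrading.mem_iff_of_map_mem [AddCommGroup G] (h : IsAlgGrading 𝒜) (hℬ : ⨆ g, ℬ g = ⊤)
    (φ : B ≃ₗ[F] A)
    (hφ : ∀ g, ∀ b ∈ ℬ g, φ b ∈ 𝒜 g) (g : G) (b : B) : b ∈ ℬ g ↔ φ b ∈ 𝒜 g := by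
  classical
  refine ⟨hφ g b, fun hb => ?_⟩
  have key : ∀ b, φ.symm (h.proj g (φ b)) ∈ ℬ g := by
    intro b
    induction (show b ∈ ⨆ g, ℬ g by simp [hℬ]) using Submodule.iSup_induction' with
    | mem k x hx =>
      rw [h.proj_of_mem (hφ k x hx)]
      split_ifs with hk
      · simpa [hk] using hx
      · simp
    | zero => simp
    | add x y _ _ hx hy => simpa using Submodule.add_mem _ hx hy
  simpa [h.proj_self hb] using key b

theorem IsGradedSimple.of_linearEquiv (hS : IsGradedSimple 𝒜) (φ : B ≃ₗ[F] A)
    (hmul : ∀ a b, φ (a * b) = φ a * φ b) (hgr : ∀ g b, b ∈ ℬ g ↔ φ b ∈ 𝒜 g) :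
    IsGradedSimple ℬ where
  mul_ne_zero := by
    obtain ⟨a, b, hab⟩ := hS.mul_ne_zero
    refine ⟨φ.symm a, φ.symm b, fun h0 => hab ?_⟩
    simpa [hmul] using congrArg φ h0
  eq_bot_or_eq_top I hI := by
    have hmap : ∀ g, (I ⊓ ℬ g).map φ.toLinearMap = I.map φ.toLinearMap ⊓ 𝒜 g := by
      intro g
      ext x
      constructor
      · rintro ⟨y, ⟨hy, hyg⟩, rfl⟩
        exact ⟨⟨y, hy, rfl⟩, (hgr g y).1 hyg⟩
      · rintro ⟨⟨y, hy, rfl⟩, hyg⟩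
        exact ⟨y, ⟨hy, (hgr g y).2 hyg⟩, rfl⟩
    have hφI : IsGradedIdeal 𝒜 (I.map φ.toLinearMap) := by
      refine ⟨?_, ?_, ?_⟩
      · rintro a _ ⟨x, hx, rfl⟩
        exact ⟨φ.symm a * x, hI.mul_mem_left _ _ hx, by simp [hmul]⟩
      · rintro a _ ⟨x, hx, rfl⟩
        exact ⟨x * φ.symm a, hI.mul_mem_right _ _ hx, by simp [hmul]⟩
      · conv_lhs => rw [hI.graded]
        rw [Submodule.map_iSup]
        simp only [hmap]
    rcases hS.eq_bot_or_eq_top _ hφI with hb | ht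
    · left
      exact Submodule.map_injective_of_injective φ.injective (hb.trans (Submodule.map_bot _).symm)
    · right
      rw [eq_top_iff]
      intro x _
      obtain ⟨y, hy, hyx⟩ : φ x ∈ I.map φ.toLinearMap := by simp [ht]
      rwa [← φ.injective hyx]

theorem iSup_matrixGrading [AddCommGroup G] {H : AddSubgroup G} (ζ : TwoCocycle H F) {k : ℕ}
    (θ : Fin k → G) :
    ⨆ g, matrixGrading ζ θ g = ⊤ := by
  rw [eq_top_iff]
  intro M _
  rw [Matrix.matrix_eq_sum_single M]
  refine Submodule.sum_mem _ fun i _ => Submodule.sum_mem _ fun j _ => ?_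
  induction M i j using TwistedGroupAlgebra.induction_on with
  | h0 => simp
  | hadd a b ha hb =>
    rw [Matrix.single_add]
    exact Submodule.add_mem _ ha hb
  | hη c ξ =>
    rw [← Matrix.smul_single]
    exact Submodule.smul_mem _ _ (Submodule.mem_iSup_of_mem _
      (Submodule.subset_span ⟨i, j, ξ, rfl, rfl⟩))

theorem IsFrame.exists_matrix_equiv [AddCommGroup G] [Fintype G] [IsScalarTower F A A]
    [SMulCommClass F A A]
    {e : A} {H : AddSubgroup G} {η : H → A} {ι : Type*} [Fintype ι] {θ : ι → G} {v w : ι → A}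
    (hf : IsFrame 𝒜 e θ v w) (hS : IsGradedSimple 𝒜) (h : IsAlgGrading 𝒜)
    (hη : IsGroupCorner 𝒜 H e η) :
    ∃ (k : ℕ) (f : Fin k ≃ ι) (φ : TwistedMatrix (trivialTwoCocycle H F) k ≃ₗ[F] A), 0 < k ∧
      (∀ M N, φ (M * N) = φ M * φ N) ∧
      (∀ g M, M ∈ matrixGrading (trivialTwoCocycle H F) (θ ∘ f) g ↔ φ M ∈ 𝒜 g) ∧
      ∀ i j ξ, φ (basisElt _ i j ξ) = v (f i) * η ξ * w (f j) := by
  let f := (Fintype.equivFin ι).symm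
  obtain ⟨φ, hφ, hφb⟩ := (hf.reindex f).exists_linearEquiv hS h hη
  refine ⟨_, f, φ, ?_, hφ, h.mem_iff_of_map_mem (iSup_matrixGrading _ _) φ fun g M hM => ?_, hφb⟩
  · rw [Fintype.card_pos_iff, ← not_isEmpty_iff]
    intro hι
    refine hη.ne_zero ?_
    rw [← hf.sum_mul e hη.e_mul_e]
    simp
  · induction hM using Submodule.span_induction with
    | mem x hx =>
      obtain ⟨i, j, ξ, rfl, rfl⟩ := hx
      rw [hφb]
      exact h.mul_mem _ _ _ _ (h.mul_mem _ _ _ _ (hf.v_mem _) (hη.mem ξ)) (hf.w_mem _)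
    | zero => simp
    | add x y _ _ hx hy =>
      rw [map_add]
      exact Submodule.add_mem _ hx hy
    | smul c x _ hx =>
      rw [map_smul]
      exact Submodule.smul_mem _ _ hx

end Transfer

/-! ### Graded ideals as subalgebras -/

section Ideal

variable {F G A : Type*} [Field F] [NonUnitalRing A] [Module F A]
  {𝒜 : G → Submodule F A} {σ : A →ₗ[F] A}

/-- A graded ideal as a subalgebra. -/
def IsGradedIdeal.toSubalgebra {I : Submodule F A} (hI : IsGradedIdeal 𝒜 I) :
    NonUnitalSubalgebra F A :=
  { I with mul_mem' := fun {a b} _ hb => hI.mul_mem_left a b hb }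

/-- The inclusion of a graded ideal as a linear map. -/
def IsGradedIdeal.incl {I : Submodule F A} (hI : IsGradedIdeal 𝒜 I) :
    hI.toSubalgebra →ₗ[F] A where
  toFun x := x
  map_add' _ _ := rfl
  map_smul' _ _ := rfl

theorem IsGradedIdeal.incl_apply {I : Submodule F A} (hI : IsGradedIdeal 𝒜 I)
    (x : hI.toSubalgebra) : hI.incl x = x := rfl

/-- Both products lie in `I ∩ σ I`. -/
theorem IsGradedInvolution.star_mul_eq_zero {I : Submodule F A}
    (hσ : IsGradedInvolution 𝒜 σ) (hI : IsGradedIdeal 𝒜 I)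
    (hdisj : ∀ x ∈ I, σ x ∈ I → x = 0) {x y : A} (hx : x ∈ I) (hy : y ∈ I) :
    σ y * x = 0 ∧ x * σ y = 0 := by
  constructor
  · refine hdisj _ (hI.mul_mem_left _ _ hx) ?_
    rw [hσ.map_mul, hσ.involutive]
    exact hI.mul_mem_left _ _ hy
  · refine hdisj _ (hI.mul_mem_right _ _ hx) ?_
    rw [hσ.map_mul, hσ.involutive]
    exact hI.mul_mem_right _ _ hy

end Ideal

/-! ### Algebras that are graded simple with involution but not graded simple -/

section Split

variable {F G A : Type*} [Field F] [AddCommGroup G] [NonUnitalRing A] [Module F A]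
  {𝒜 : G → Submodule F A} {σ : A →ₗ[F] A}

theorem IsGradedInvolution.map_proj (hσ : IsGradedInvolution 𝒜 σ) (h : IsAlgGrading 𝒜)
    (g : G) (x : A) : h.proj g (σ x) = σ (h.proj g x) := by
  have := h.map_proj (d := 0) σ (fun g x hx => by simpa using hσ.map_mem g x hx) g x
  rwa [add_zero] at this

/-- For a proper nonzero graded ideal `I`, the algebra is the direct sum of `I` and `σ I`. -/
theorem IsStarGradedSimple.split [Fintype G] (hC : IsStarGradedSimple 𝒜 σ) (h : IsAlgGrading 𝒜)
    (hσ : IsGradedInvolution 𝒜 σ) {I : Submodule F A} (hI : IsGradedIdeal 𝒜 I) (hb : I ≠ ⊥)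
    (ht : I ≠ ⊤) :
    (∀ x ∈ I, σ x ∈ I → x = 0) ∧ ∀ c, ∃ x ∈ I, ∃ y ∈ I, c = x + σ y := by
  have hpr : ∀ x ∈ I, ∀ g, h.proj g x ∈ I := fun x hx g => h.proj_mem_of_graded hI.graded hx g
  constructor
  · have hK : IsGradedIdeal 𝒜 (I ⊓ I.comap σ) := by
      refine ⟨?_, ?_, h.graded_of_proj_mem ?_⟩
      · rintro a x ⟨hx, hsx⟩
        refine ⟨hI.mul_mem_left _ _ hx, ?_⟩
        change σ (a * x) ∈ I
        rw [hσ.map_mul]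
        exact hI.mul_mem_right _ _ hsx
      · rintro a x ⟨hx, hsx⟩
        refine ⟨hI.mul_mem_right _ _ hx, ?_⟩
        change σ (x * a) ∈ I
        rw [hσ.map_mul]
        exact hI.mul_mem_left _ _ hsx
      · rintro x ⟨hx, hsx⟩ g
        refine ⟨hpr x hx g, ?_⟩
        change σ (h.proj g x) ∈ I
        rw [← hσ.map_proj h]
        exact hpr _ hsx g
    rcases hC.eq_bot_or_eq_top _ hK (by
      rintro x ⟨hx, hsx⟩
      refine ⟨hsx, ?_⟩
      change σ (σ x) ∈ I
      rwa [hσ.involutive]) with h1 | h1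
    · intro x hx hsx
      have : x ∈ I ⊓ I.comap σ := ⟨hx, hsx⟩
      simpa [h1] using this
    · exact absurd (top_le_iff.1 (h1 ▸ inf_le_left)) ht
  · have hmem : ∀ c, c ∈ I ⊔ I.map σ ↔ ∃ x ∈ I, ∃ y ∈ I, c = x + σ y := by
      intro c
      rw [Submodule.mem_sup]
      constructor
      · rintro ⟨x, hx, _, ⟨y, hy, rfl⟩, rfl⟩
        exact ⟨x, hx, y, hy, rfl⟩
      · rintro ⟨x, hx, y, hy, rfl⟩
        exact ⟨x, hx, _, ⟨y, hy, rfl⟩, rfl⟩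
    have hK : IsGradedIdeal 𝒜 (I ⊔ I.map σ) := by
      refine ⟨?_, ?_, h.graded_of_proj_mem ?_⟩
      · intro a c hc
        rw [hmem] at hc ⊢
        obtain ⟨x, hx, y, hy, rfl⟩ := hc
        exact ⟨a * x, hI.mul_mem_left _ _ hx, y * σ a, hI.mul_mem_right _ _ hy, by
          rw [mul_add, hσ.map_mul, hσ.involutive]⟩
      · intro a c hc
        rw [hmem] at hc ⊢
        obtain ⟨x, hx, y, hy, rfl⟩ := hc
        exact ⟨x * a, hI.mul_mem_right _ _ hx, σ a * y, hI.mul_mem_left _ _ hy, by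
          rw [add_mul, hσ.map_mul, hσ.involutive]⟩
      · intro c hc g
        rw [hmem] at hc ⊢
        obtain ⟨x, hx, y, hy, rfl⟩ := hc
        exact ⟨_, hpr x hx g, _, hpr y hy g, by rw [map_add, hσ.map_proj h]⟩
    intro c
    rw [← hmem]
    rcases hC.eq_bot_or_eq_top _ hK (by
      intro c hc
      rw [hmem] at hc ⊢
      obtain ⟨x, hx, y, hy, rfl⟩ := hc
      exact ⟨y, hy, x, hx, by rw [map_add, hσ.involutive, add_comm]⟩) with h1 | h1
    · exact absurd (le_bot_iff.1 (h1 ▸ le_sup_left)) hb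
    · simp [h1]

theorem IsGradedIdeal.isAlgGrading [Fintype G] {I : Submodule F A} (hI : IsGradedIdeal 𝒜 I)
    (h : IsAlgGrading 𝒜) : IsAlgGrading fun g => (𝒜 g).comap hI.incl where
  indep := by
    intro g
    rw [Submodule.disjoint_def]
    intro x hx hx'
    have hle : (⨆ j, ⨆ (_ : j ≠ g), (𝒜 j).comap hI.incl) ≤
        (⨆ j, ⨆ (_ : j ≠ g), 𝒜 j).comap hI.incl :=
      iSup₂_le fun j hj => Submodule.comap_mono (le_iSup₂_of_le j hj le_rfl)
    exact Subtype.ext ((Submodule.disjoint_def.1 (h.indep g)) x hx (hle hx'))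
  iSup_eq_top := by
    rw [eq_top_iff]
    intro x _
    have hx : x = ∑ g, (⟨h.proj g x, h.proj_mem_of_graded hI.graded x.2 g⟩ : hI.toSubalgebra) := by
      apply Subtype.ext
      rw [← hI.incl_apply (∑ g, _), map_sum]
      exact (h.sum_proj (x : A)).symm
    rw [hx]
    exact Submodule.sum_mem _ fun g _ =>
      Submodule.mem_iSup_of_mem g (h.proj_mem g x)
  mul_mem g k a b ha hb := h.mul_mem g k a b ha hb

theorem IsGradedIdeal.incl_proj {I : Submodule F A} (hI : IsGradedIdeal 𝒜 I)
    (h : IsAlgGrading 𝒜) (hS : IsAlgGrading fun g => (𝒜 g).comap hI.incl) (g : G)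
    (x : hI.toSubalgebra) : hI.incl (hS.proj g x) = h.proj g (hI.incl x) := by
  classical
  induction x using hS.induction_on with
  | hom k y hy =>
    rw [hS.proj_of_mem hy, h.proj_of_mem (g := k) (x := hI.incl y) hy]
    split_ifs <;> simp
  | h0 => simp
  | hadd y z hy hz => simp [hy, hz]

/-- Since `σ I` annihilates `I`, a graded ideal `J` of `I` is a graded ideal of the whole algebra.
If `J` is nonzero, the splitting applies to `J` too, and comparing it with that of `I` gives `J =
I`. -/
theorem IsStarGradedSimple.isGradedSimple_ideal [Fintype G] (hC : IsStarGradedSimple 𝒜 σ)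
    (h : IsAlgGrading 𝒜) (hσ : IsGradedInvolution 𝒜 σ) {I : Submodule F A}
    (hI : IsGradedIdeal 𝒜 I) (hb : I ≠ ⊥) (ht : I ≠ ⊤) :
    IsGradedSimple fun g => (𝒜 g).comap hI.incl := by
  obtain ⟨hdisj, hsum⟩ := hC.split h hσ hI hb ht
  have h0 : ∀ {x y}, x ∈ I → y ∈ I → σ y * x = 0 ∧ x * σ y = 0 :=
    fun hx hy => hσ.star_mul_eq_zero hI hdisj hx hy
  constructor
  · by_contra! hz
    have hz' : ∀ {x y}, x ∈ I → y ∈ I → x * y = 0 := fun hx hy =>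
      congrArg Subtype.val (hz ⟨_, hx⟩ ⟨_, hy⟩)
    obtain ⟨a, b, hab⟩ := hC.mul_ne_zero
    obtain ⟨x, hx, y, hy, rfl⟩ := hsum a
    obtain ⟨x', hx', y', hy', rfl⟩ := hsum b
    apply hab
    rw [add_mul, mul_add, mul_add, hz' hx hx', (h0 hx hy').2, (h0 hx' hy).1, ← hσ.map_mul,
      hz' hy' hy, map_zero]
    simp
  · intro J hJ
    by_cases hJb : J = ⊥
    · exact Or.inl hJb
    right
    have hJI : ∀ x ∈ J.map hI.incl, x ∈ I := by
      rintro _ ⟨x, -, rfl⟩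
      exact x.2
    have hJ' : IsGradedIdeal 𝒜 (J.map hI.incl) := by
      refine ⟨?_, ?_, h.graded_of_proj_mem ?_⟩
      · rintro a _ ⟨x, hx, rfl⟩
        obtain ⟨y, hy, z, hz, rfl⟩ := hsum a
        refine ⟨⟨y, hy⟩ * x, hJ.mul_mem_left _ _ hx, ?_⟩
        rw [add_mul, hI.incl_apply x, (h0 x.2 hz).1, add_zero]
        rfl
      · rintro a _ ⟨x, hx, rfl⟩
        obtain ⟨y, hy, z, hz, rfl⟩ := hsum a
        refine ⟨x * ⟨y, hy⟩, hJ.mul_mem_right _ _ hx, ?_⟩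
        rw [mul_add, hI.incl_apply x, (h0 x.2 hz).2, add_zero]
        rfl
      · rintro _ ⟨x, hx, rfl⟩ g
        have hS := hI.isAlgGrading h
        exact ⟨hS.proj g x, hS.proj_mem_of_graded hJ.graded hx g, hI.incl_proj h hS g x⟩
    obtain ⟨-, hsum'⟩ := hC.split h hσ hJ'
      (fun h' => hJb (Submodule.map_injective_of_injective (f := hI.incl) Subtype.val_injective
        (h'.trans (Submodule.map_bot _).symm)))
      (fun h' => ht (top_le_iff.1 (h' ▸ hJI)))
    rw [eq_top_iff]
    rintro x -
    obtain ⟨y, hy, z, hz, hxyz⟩ := hsum' x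
    have hxy : (x : A) - y ∈ I := I.sub_mem x.2 (hJI y hy)
    -- From `x = y + σ z` with `x` and `y` in `I`, the element `σ z` lies in `I ∩ σ I`.
    have hz0 : z = 0 := by
      refine hdisj z (hJI z hz) ?_
      rwa [← sub_eq_iff_eq_add'.2 hxyz]
    rw [hz0, map_zero, add_zero] at hxyz
    obtain ⟨y', hy', hyy⟩ := hy
    rwa [show x = y' from Subtype.ext (hxyz.trans hyy.symm)]

/-- An isomorphism `B ≃ I` extends to an isomorphism from `B × B^op` to `I ⊕ σ I`. -/
theorem IsStarGradedSimple.gradedStarIsomorphic_exchange {B : Type*} [NonUnitalRing B] [Module F B]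
    {ℬ : G → Submodule F B} (h : IsAlgGrading 𝒜)
    (hσ : IsGradedInvolution 𝒜 σ) {I : Submodule F A} (hI : IsGradedIdeal 𝒜 I)
    (hdisj : ∀ x ∈ I, σ x ∈ I → x = 0) (hsum : ∀ c, ∃ x ∈ I, ∃ y ∈ I, c = x + σ y)
    (φ : B ≃ₗ[F] hI.toSubalgebra) (hφ : ∀ a b, φ (a * b) = φ a * φ b)
    (hgr : ∀ g b, b ∈ ℬ g ↔ (φ b : A) ∈ 𝒜 g) :
    GradedStarIsomorphic 𝒜 σ (prodOpGrading ℬ) (exchange F B) := by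
  have h0 : ∀ {x y}, x ∈ I → y ∈ I → σ y * x = 0 ∧ x * σ y = 0 :=
    fun hx hy => hσ.star_mul_eq_zero hI hdisj hx hy
  -- Uniqueness of the decomposition along `I ⊕ σ I` yields injectivity, and later shows that both
  -- parts of a homogeneous element are homogeneous.
  have hdec : ∀ {x y x' y'}, x ∈ I → y ∈ I → x' ∈ I → y' ∈ I → x + σ y = x' + σ y' →
      x = x' ∧ y = y' := by
    intro x y x' y' hx hy hx' hy' hxy
    have h1 : σ (y' - y) = x - x' := by
      rw [map_sub, sub_eq_sub_iff_add_eq_add, add_comm, ← hxy, add_comm]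
    have h2 : y' - y = 0 := hdisj _ (I.sub_mem hy' hy) (h1 ▸ I.sub_mem hx hx')
    rw [h2, map_zero] at h1
    exact ⟨(sub_eq_zero.1 h1.symm), (sub_eq_zero.1 h2).symm⟩
  let ψ : (B × Bᵐᵒᵖ) →ₗ[F] A :=
    { toFun := fun p => (φ p.1 : A) + σ (φ p.2.unop)
      map_add' := fun p q => by
        simp only [Prod.fst_add, Prod.snd_add, MulOpposite.unop_add, map_add,
          NonUnitalSubalgebra.coe_add]
        abel
      map_smul' := fun c p => by
        simp only [Prod.smul_fst, Prod.smul_snd, MulOpposite.unop_smul, map_smul,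
          NonUnitalSubalgebra.coe_smul, smul_add, RingHom.id_apply] }
  have hψ : ∀ p, ψ p = (φ p.1 : A) + σ (φ p.2.unop) := fun p => rfl
  have hbij : Function.Bijective ψ := by
    constructor
    · intro p q hpq
      obtain ⟨h1, h2⟩ := hdec (φ p.1).2 (φ p.2.unop).2 (φ q.1).2 (φ q.2.unop).2 hpq
      exact Prod.ext (φ.injective (Subtype.ext h1))
        (MulOpposite.unop_injective (φ.injective (Subtype.ext h2)))
    · intro c
      obtain ⟨x, hx, y, hy, rfl⟩ := hsum c
      refine ⟨(φ.symm ⟨x, hx⟩, MulOpposite.op (φ.symm ⟨y, hy⟩)), ?_⟩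
      rw [hψ]
      simp
  have hψmul : ∀ p q, ψ (p * q) = ψ p * ψ q := by
    intro p q
    simp only [hψ, Prod.fst_mul, Prod.snd_mul, MulOpposite.unop_mul, hφ,
      NonUnitalSubalgebra.coe_mul, add_mul, mul_add, hσ.map_mul]
    rw [(h0 (φ p.1).2 (φ q.2.unop).2).2, (h0 (φ q.1).2 (φ p.2.unop).2).1, zero_add, add_zero]
  have hψgr : ∀ g p, p ∈ prodOpGrading ℬ g ↔ ψ p ∈ 𝒜 g := by
    intro g p
    have hp : p ∈ prodOpGrading ℬ g ↔ p.1 ∈ ℬ g ∧ p.2.unop ∈ ℬ g := Iff.rfl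
    rw [hp, hψ, hgr, hgr]
    constructor
    · rintro ⟨h1, h2⟩
      exact Submodule.add_mem _ h1 (hσ.map_mem _ _ h2)
    · intro hm
      have hm' := h.proj_self hm
      rw [map_add, hσ.map_proj h] at hm'
      obtain ⟨h1, h2⟩ := hdec (h.proj_mem_of_graded hI.graded (φ p.1).2 g)
        (h.proj_mem_of_graded hI.graded (φ p.2.unop).2 g) (φ p.1).2 (φ p.2.unop).2 hm'
      rw [← h1, ← h2]
      exact ⟨h.proj_mem _ _, h.proj_mem _ _⟩
  have hψσ : ∀ p, ψ (exchange F B p) = σ (ψ p) := by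
    intro p
    rw [hψ, hψ, map_add, hσ.involutive, add_comm]
    rfl
  let Ψ := LinearEquiv.ofBijective ψ hbij
  have hΨ : ∀ a, ψ (Ψ.symm a) = a := fun a => Ψ.apply_symm_apply a
  refine ⟨Ψ.symm, fun a b => ?_, fun g a => ?_, fun a => ?_⟩
  · apply hbij.1
    rw [hψmul, hΨ, hΨ, hΨ]
  · rw [hψgr, hΨ]
  · apply hbij.1
    rw [hψσ, hΨ, hΨ]

end Split

/-! ### The dichotomy: graded simple, or two ideals exchanged by the involution -/

theorem mainTheorem5 {F : Type*} [Field F] [IsAlgClosed F] [CharZero F]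
    {G : Type*} [AddCommGroup G] [IsAddCyclic G]
    (hG : (Nat.card G).Prime ∨ Nat.card G = 4)
    {C : Type*} [NonUnitalRing C] [Module F C] [IsScalarTower F C C] [SMulCommClass F C C]
    [FiniteDimensional F C]
    (𝒜 : G → Submodule F C) (h𝒜 : IsAlgGrading 𝒜)
    (σ : C →ₗ[F] C) (hσ : IsGradedInvolution 𝒜 σ)
    (hC : IsStarGradedSimple 𝒜 σ) :
    ∃ (H : AddSubgroup G) (ζ : TwoCocycle H F) (k : ℕ) (θ : Fin k → G),
      0 < k ∧
      (∀ x y : H, (ζ.toFun x y : F) ∈ cyclotomicSubfield F (Nat.card G)) ∧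
      IsGradedSimple (matrixGrading ζ θ) ∧
      ((∃ τ : TwistedMatrix ζ k →ₗ[F] TwistedMatrix ζ k, IsElementaryInvolution ζ θ τ ∧
          GradedStarIsomorphic 𝒜 σ (matrixGrading ζ θ) τ) ∨
        GradedStarIsomorphic 𝒜 σ (prodOpGrading (matrixGrading ζ θ))
          (exchange F (TwistedMatrix ζ k))) := by
  have hG0 : Nat.card G ≠ 0 := by
    rcases hG with hG | hG
    · exact hG.ne_zero
    · omega
  have := Nat.finite_of_card_ne_zero hG0
  have := Fintype.ofFinite G
  by_cases hS : IsGradedSimple 𝒜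
  · obtain ⟨H, e, η, hη⟩ := hS.exists_isGroupCorner h𝒜
    obtain ⟨ι, _, θ, v, w, hf, hel⟩ := hS.exists_isFrame_elementary h𝒜 hη hσ
    obtain ⟨k, f, φ, hk, hφ, hgr, hφb⟩ := hf.exists_matrix_equiv hS h𝒜 hη
    -- The elementary involution is `σ` transported through `φ`; the cocycle takes only the value
    -- one.
    refine ⟨H, trivialTwoCocycle H F, k, θ ∘ f, hk, fun x y => one_mem _,
      hS.of_linearEquiv φ hφ hgr, Or.inl ⟨φ.symm.toLinearMap ∘ₗ σ ∘ₗ φ.toLinearMap, ⟨⟨?_, ?_, ?_⟩,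
        fun i j ξ => ?_⟩, φ.symm, fun a b => ?_, fun g a => ?_, fun a => ?_⟩⟩
    · intro a b
      apply φ.injective
      simp [hφ, hσ.map_mul]
    · intro a
      simp [hσ.involutive]
    · intro g a ha
      rw [hgr] at ha ⊢
      simpa using hσ.map_mem g _ ha
    · obtain ⟨i', j', ξ', h1⟩ := hel (f i) (f j) ξ
      refine ⟨f.symm i', f.symm j', ξ', ?_⟩
      simp only [LinearMap.comp_apply, LinearEquiv.coe_coe, LinearEquiv.symm_apply_eq, map_neg,
        hφb, Equiv.apply_symm_apply]
      exact h1
    · apply φ.injective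
      simp [hφ]
    · rw [hgr]
      simp
    · simp
  · obtain ⟨I, hI, hb, ht⟩ : ∃ I, IsGradedIdeal 𝒜 I ∧ I ≠ ⊥ ∧ I ≠ ⊤ := by
      by_contra! hn
      exact hS ⟨hC.mul_ne_zero, fun I hI => or_iff_not_imp_left.2 (hn I hI)⟩
    have hSI := hC.isGradedSimple_ideal h𝒜 hσ hI hb ht
    have hAI := hI.isAlgGrading h𝒜
    obtain ⟨hdisj, hsum⟩ := hC.split h𝒜 hσ hI hb ht
    have : FiniteDimensional F hI.toSubalgebra :=
      FiniteDimensional.of_injective hI.incl Subtype.val_injective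
    -- The involution does not preserve `I`, so a plain frame of `I` is used; the exchange
    -- involution carries all the information about `σ`.
    obtain ⟨H, e, η, hη⟩ := hSI.exists_isGroupCorner hAI
    obtain ⟨ι, _, θ, v, w, hf⟩ := hSI.exists_isFrame hAI hη
    obtain ⟨k, f, φ, hk, hφ, hgr, -⟩ := hf.exists_matrix_equiv hSI hAI hη
    exact ⟨H, trivialTwoCocycle H F, k, θ ∘ f, hk, fun x y => one_mem _,
      hSI.of_linearEquiv φ hφ hgr, Or.inr
        (IsStarGradedSimple.gradedStarIsomorphic_exchange h𝒜 hσ hI hdisj hsum φ hφ hgr)⟩
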